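/- Let $\Sigma\subset\mathbb R^2$ be open and let $f:\Sigma\to\mathbb R^3$ be a (wave) front with unit normal vector field $\nu$: $f$ and $\nu$ are $C^\infty$, $|\nu|=1$, $\langle df,\nu\rangle=0$, and $(f,\nu)$ is an immersion. Let $p\in\Sigma$ be a cuspidal edge of $f$, i.e. the germ of $f$ at $p$ is $\mathcal A$-equivalent to $(u,v)\mapsto(u,v^2,v^3)$ at $0$. Put $\lambda=\det(f_u,f_v,\nu)$. At the regular points of $f$ near $p$ let $\kappa_1,\kappa_2$ be the principal curvatures of $f$ (so $\kappa_1+\kappa_2=2H$ and $\kappa_1\kappa_2=K$, with $K,H$ the Gaussian and mean curvatures of $f$ with respect to $\nu$), labelled so that $\kappa_2$ is bounded near $p$; such a labelling exists. Let $\hat\kappa$ be the extension of $\lambda\kappa_1$ by limits to the singular points of $f$. An adapted coordinate system at $p$ is a local $C^\infty$ coordinate system $(u,v)$ of $\Sigma$ centered at $p$ in which the singular points of $f$ are exactly the points of the $u$-axis and $f_v=0$ on the $u$-axis; such systems exist. In an adapted coordinate system (with $\lambda=\det(f_u,f_v,\nu)$ taken in these coordinates) put, along the $u$-axis, $$\kappa_s=\operatorname{sgn}(\lambda_v)\frac{\det(f_u,f_{uu},\nu)}{|f_u|^3},\qquad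 \kappa_c=\frac{|f_u|^{3/2}\det(f_u,f_{vv},f_{vvv})}{|f_u\times f_{vv}|^{5/2}},$$ $$\kappa_t=\frac{\det(f_u,f_{vv},f_{uvv})}{|f_u\times f_{vv}|^2}-\frac{\det(f_u,f_{vv},f_{uu})\langle f_u,f_{vv}\rangle}{|f_u|^2|f_u\times f_{vv}|^2}.$$ Then, on some open neighborhood $V\subset\Sigma$ of $p$, the function $\hat\kappa$ is $C^\infty$, has no zeros and equals $\lambda\kappa_1$ at the regular points of $f$; the focal surface $$\widehat{FC}_f=f+\frac{\lambda}{\hat\kappa}\,\nu$$ is $C^\infty$ and regular (an immersion) on $V$; and it has a $C^\infty$ unit normal vector field $n$ on $V$ such that, for every adapted coordinate system at $p$, at every point of $V$ on its $u$-axis (the singular curve of $f$), the Gaussian curvature of $\widehat{FC}_f$ is $$K=-\tfrac14\left(4\kappa_t^2+\kappa_s\kappa_c^2\right),$$ and its mean curvature is $$H=+\tfrac18\left(\kappa_c^2-4\kappa_s\right)\ \text{ with respect to } n,\qquad H=-\tfrac18\left(\kappa_c^2-4\kappa_s\right)\ \text{ with respect to } -n.$$ -/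

import Mathlib

open scoped ContDiff Topology

noncomputable section

namespace FocalSurface

/-- Euclidean three-space. -/
abbrev E3 := EuclideanSpace ℝ (Fin 3)

/-- The partial derivative with respect to the first parameter `u`. -/
def du {E : Type*} [NormedAddCommGroup E] [NormedSpace ℝ E] (F : ℝ × ℝ → E) (q : ℝ × ℝ) : E :=
  fderiv ℝ F q (1, 0)

/-- The partial derivative with respect to the second parameter `v`. -/
def dv {E : Type*} [NormedAddCommGroup E] [NormedSpace ℝ E] (F : ℝ × ℝ → E) (q : ℝ × ℝ) : E :=
  fderiv ℝ F q (0, 1)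

/-- The determinant of three vectors of `ℝ³`. -/
def det3 (a b c : E3) : ℝ := Matrix.det (Matrix.of ![a.ofLp, b.ofLp, c.ofLp])

/-- The cross product of `ℝ³`, with values in Euclidean space, so that its norm is the
Euclidean one. -/
def cross (a b : E3) : E3 := WithLp.toLp 2 (crossProduct a.ofLp b.ofLp)

/-- The points at which the differential of `F` is injective. The other points are the
singular points of `F`. -/
def regularSet (F : ℝ × ℝ → E3) : Set (ℝ × ℝ) :=
  {q | Function.Injective (fderiv ℝ F q)}

/-- `n` is a smooth unit vector field along `F`, normal to `F`, on `S`. -/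
structure IsUnitNormalOn (F n : ℝ × ℝ → E3) (S : Set (ℝ × ℝ)) : Prop where
  smooth : ContDiffOn ℝ ∞ n S
  norm_eq_one : ∀ q ∈ S, ‖n q‖ = 1
  orthogonal : ∀ q ∈ S, ∀ X : ℝ × ℝ, inner ℝ (fderiv ℝ F q X) (n q) = 0

/-- `f` is a wave front on `S` with unit normal vector field `ν`: a smooth map such that
`(f, ν)` is an immersion. -/
structure IsFrontOn (f ν : ℝ × ℝ → E3) (S : Set (ℝ × ℝ)) : Prop where
  smooth : ContDiffOn ℝ ∞ f S
  normal : IsUnitNormalOn f ν S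
  immersion : ∀ q ∈ S, Function.Injective (fderiv ℝ (fun x => (f x, ν x)) q)

/-- `f` has a cuspidal edge at `p`: its germ at `p` is `𝒜`-equivalent to the germ of
`(u, v) ↦ (u, v², v³)` at the origin. -/
def IsCuspidalEdgeAt (f : ℝ × ℝ → E3) (p : ℝ × ℝ) : Prop :=
  ∃ (θ : OpenPartialHomeomorph (ℝ × ℝ) (ℝ × ℝ)) (Θ : OpenPartialHomeomorph E3 E3),
    ContDiffOn ℝ ∞ θ θ.source ∧ ContDiffOn ℝ ∞ θ.symm θ.target ∧
    ContDiffOn ℝ ∞ Θ Θ.source ∧ ContDiffOn ℝ ∞ Θ.symm Θ.target ∧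
    p ∈ θ.source ∧ θ p = 0 ∧ f p ∈ Θ.source ∧ Θ (f p) = 0 ∧
    ∀ᶠ q in 𝓝 p, Θ (f q) = !₂[(θ q).1, (θ q).2 ^ 2, (θ q).2 ^ 3]

/-- The signed area density `λ = det(f_u, f_v, ν)`. -/
def signedArea (f ν : ℝ × ℝ → E3) (q : ℝ × ℝ) : ℝ := det3 (du f q) (dv f q) (ν q)

/-! First and second fundamental forms, Gaussian and mean curvature of `F` with respect to the
unit normal `n`; they are meant at the regular points of `F`. -/

def coeffE (F : ℝ × ℝ → E3) (q : ℝ × ℝ) : ℝ := inner ℝ (du F q) (du F q)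
def coeffF (F : ℝ × ℝ → E3) (q : ℝ × ℝ) : ℝ := inner ℝ (du F q) (dv F q)
def coeffG (F : ℝ × ℝ → E3) (q : ℝ × ℝ) : ℝ := inner ℝ (dv F q) (dv F q)
def coeffL (F n : ℝ × ℝ → E3) (q : ℝ × ℝ) : ℝ := inner ℝ (du (du F) q) (n q)
def coeffM (F n : ℝ × ℝ → E3) (q : ℝ × ℝ) : ℝ := inner ℝ (dv (du F) q) (n q)
def coeffN (F n : ℝ × ℝ → E3) (q : ℝ × ℝ) : ℝ := inner ℝ (dv (dv F) q) (n q)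

def gaussCurv (F n : ℝ × ℝ → E3) (q : ℝ × ℝ) : ℝ :=
  (coeffL F n q * coeffN F n q - coeffM F n q ^ 2) /
    (coeffE F q * coeffG F q - coeffF F q ^ 2)

def meanCurv (F n : ℝ × ℝ → E3) (q : ℝ × ℝ) : ℝ :=
  (coeffE F q * coeffN F n q - 2 * coeffF F q * coeffM F n q + coeffG F q * coeffL F n q) /
    (2 * (coeffE F q * coeffG F q - coeffF F q ^ 2))

/-- Near `p`, the numbers `κ₁` and `κ₂` are the two principal curvatures of `f` at the regular
points (that is, `κ₁ + κ₂ = 2H` and `κ₁ κ₂ = K`), labelled so that `κ₂` is bounded near `p`. -/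
structure IsPrincipalPairAt (f ν : ℝ × ℝ → E3) (p : ℝ × ℝ) (κ₁ κ₂ : ℝ × ℝ → ℝ) : Prop where
  add_eq : ∀ᶠ q in 𝓝 p, q ∈ regularSet f → κ₁ q + κ₂ q = 2 * meanCurv f ν q
  mul_eq : ∀ᶠ q in 𝓝 p, q ∈ regularSet f → κ₁ q * κ₂ q = gaussCurv f ν q
  bounded : ∃ C : ℝ, ∀ᶠ q in 𝓝 p, q ∈ regularSet f → |κ₂ q| ≤ C

/-- The extension of `λ κ₁` across the singular set of `f`, by limits along regular points. -/
def kappaHat (f ν : ℝ × ℝ → E3) (κ₁ : ℝ × ℝ → ℝ) : ℝ × ℝ → ℝ :=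
  extendFrom (regularSet f) (fun q => signedArea f ν q * κ₁ q)

/-- The focal surface `f + (λ / κ̂) ν`. -/
def focalHat (f ν : ℝ × ℝ → E3) (κ₁ : ℝ × ℝ → ℝ) (q : ℝ × ℝ) : E3 :=
  f q + (signedArea f ν q / kappaHat f ν κ₁ q) • ν q

/-- `φ` is (the inverse of) an adapted coordinate system `(u, v)` centred at `p`, inside the
domain `S` of `f`: a diffeomorphism between open sets with `φ 0 = p`, such that the singular
points of `f ∘ φ` are the points of the `u`-axis, and `∂_v` is a null vector field there. -/
structure IsAdaptedAt (f : ℝ × ℝ → E3) (S : Set (ℝ × ℝ)) (p : ℝ × ℝ)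
    (φ : OpenPartialHomeomorph (ℝ × ℝ) (ℝ × ℝ)) : Prop where
  smooth : ContDiffOn ℝ ∞ φ φ.source
  smooth_symm : ContDiffOn ℝ ∞ φ.symm φ.target
  zero_mem : (0, 0) ∈ φ.source
  map_zero : φ (0, 0) = p
  target_subset : φ.target ⊆ S
  singular_iff : ∀ x ∈ φ.source, x ∉ regularSet (f ∘ φ) ↔ x.2 = 0
  null : ∀ u : ℝ, (u, 0) ∈ φ.source → dv (f ∘ φ) (u, 0) = 0

/-! Invariants of a cuspidal edge, at the point `(u, 0)`, for a front `g` with unit normal `ν`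
written in adapted coordinates. -/

/-- The singular curvature `κ_s`. -/
def singularCurv (g ν : ℝ × ℝ → E3) (u : ℝ) : ℝ :=
  Real.sign (dv (signedArea g ν) (u, 0)) *
    det3 (du g (u, 0)) (du (du g) (u, 0)) (ν (u, 0)) / ‖du g (u, 0)‖ ^ 3

/-- The cuspidal curvature `κ_c`. -/
def cuspidalCurv (g : ℝ × ℝ → E3) (u : ℝ) : ℝ :=
  ‖du g (u, 0)‖ ^ (3 / 2 : ℝ) *
      det3 (du g (u, 0)) (dv (dv g) (u, 0)) (dv (dv (dv g)) (u, 0)) /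
    ‖cross (du g (u, 0)) (dv (dv g) (u, 0))‖ ^ (5 / 2 : ℝ)

/-- The cusp-directional torsion `κ_t`. -/
def cuspTorsion (g : ℝ × ℝ → E3) (u : ℝ) : ℝ :=
  det3 (du g (u, 0)) (dv (dv g) (u, 0)) (dv (dv (du g)) (u, 0)) /
      ‖cross (du g (u, 0)) (dv (dv g) (u, 0))‖ ^ 2 -
    det3 (du g (u, 0)) (dv (dv g) (u, 0)) (du (du g) (u, 0)) *
        inner ℝ (du g (u, 0)) (dv (dv g) (u, 0)) /
      (‖du g (u, 0)‖ ^ 2 * ‖cross (du g (u, 0)) (dv (dv g) (u, 0))‖ ^ 2)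

end FocalSurface

end

open FocalSurface

namespace FocalSurface

/-! The densities λ, A = 2λH and B = λK are determinants in df, dν and ν (`signedArea`, `mixedArea`,
`normalArea`), hence smooth across the singular set, and at regular points λκ₁ and λκ₂ are the roots
of X² - A X + λB = 0. At p one has λ = 0, while A ≠ 0 because (f, ν) is an immersion
(`nondegenerate_of_isCuspidalEdgeAt`). So near p both roots are smooth, one close to A and one close
to 0. Boundedness of κ₂ forces λκ₁ to be the first, called k (`exists_root`,
`IsPrincipalPairAt.eventually_eq`). Since dλ ≠ 0, regular points are dense, and κ̂ = k
(`kappaHat_eq`).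

Put ρ = λ/k. On the axis of an adapted chart ρ = 0 and f_v = 0, so C = f + ρν has C_u = f_u and C_v
= ρ_v ν, with ρ_v = λ_v/A ≠ 0 (λ and A taken in the chart). Hence C is regular and its unit normal n
is orthogonal to f_u and ν. Its second fundamental form is L = ⟨f_uu, n⟩, M = ρ_v⟨ν_u, n⟩, N =
⟨f_vv, n⟩ + 2ρ_v⟨ν_v, n⟩ = -⟨f_vv, n⟩. Writing κ_s, κ_c², κ_t through the same pairings with n gives
the formulas (`curvatures_on_axis`, `focal_curvature_algebra`).

The sign of n is fixed by k det(C_u, C_v, n) > 0. A change of chart multiplies the corresponding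
product by the square of the Jacobian, so one n serves all adapted charts. On the axis the condition
says ⟨f_vv, n⟩ < 0. -/

/-! ### Determinants, cross products and Lagrange identities in ℝ³. -/

theorem inner_coord (x y : E3) : inner ℝ x y = x 0 * y 0 + x 1 * y 1 + x 2 * y 2 := by
  simp [PiLp.inner_apply, Fin.sum_univ_three, mul_comm]

theorem det3_coord (a b c : E3) : det3 a b c =
    a 0 * b 1 * c 2 - a 0 * b 2 * c 1 - a 1 * b 0 * c 2 + a 1 * b 2 * c 0
      + a 2 * b 0 * c 1 - a 2 * b 1 * c 0 := by
  simp [det3, Matrix.det_fin_three]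

theorem cross_zero (a b : E3) : cross a b 0 = a 1 * b 2 - a 2 * b 1 := by
  simp [cross, crossProduct]

theorem cross_one (a b : E3) : cross a b 1 = a 2 * b 0 - a 0 * b 2 := by
  simp [cross, crossProduct]

theorem cross_two (a b : E3) : cross a b 2 = a 0 * b 1 - a 1 * b 0 := by
  simp [cross, crossProduct]

theorem E3.ext_coord {x y : E3} (h0 : x 0 = y 0) (h1 : x 1 = y 1) (h2 : x 2 = y 2) : x = y := by
  ext i
  fin_cases i <;> assumption

theorem inner_cross (a b c : E3) : inner ℝ (cross a b) c = det3 a b c := by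
  rw [inner_coord, det3_coord, cross_zero, cross_one, cross_two]; ring

/-- The determinant as a pairing with its middle argument. -/
theorem det3_eq_inner_mid (a b c : E3) : det3 a b c = inner ℝ b (cross c a) := by
  rw [inner_coord, det3_coord, cross_zero, cross_one, cross_two]; ring

theorem inner_left_cross (a b : E3) : inner ℝ a (cross a b) = 0 := by
  rw [inner_coord, cross_zero, cross_one, cross_two]; ring

theorem inner_right_cross (a b : E3) : inner ℝ b (cross a b) = 0 := by
  rw [inner_coord, cross_zero, cross_one, cross_two]; ring

theorem det3_zero_mid (a c : E3) : det3 a 0 c = 0 := by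
  simp [det3_coord]

theorem det3_swap_right (a b c : E3) : det3 a b c = -det3 a c b := by
  simp only [det3_coord]; ring

theorem det3_smul_mid (r : ℝ) (a b c : E3) : det3 a (r • b) c = r * det3 a b c := by
  simp only [det3_coord, PiLp.smul_apply, smul_eq_mul]; ring

theorem det3_smul_right (r : ℝ) (a b c : E3) : det3 a b (r • c) = r * det3 a b c := by
  simp only [det3_coord, PiLp.smul_apply, smul_eq_mul]; ring

theorem det3_change (a b c d : ℝ) (x y z : E3) :
    det3 (a • x + b • y) (c • x + d • y) z = (a * d - b * c) * det3 x y z := by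
  simp only [det3_coord, PiLp.smul_apply, PiLp.add_apply, smul_eq_mul]; ring

/-- Polarization of `det3_change`; it makes the density 2λH scale by the Jacobian just as λ and λK
do. -/
theorem det3_change_polarized (a b c d : ℝ) (x y x' y' z : E3) :
    det3 (a • x' + b • y') (c • x + d • y) z + det3 (a • x + b • y) (c • x' + d • y') z =
      (a * d - b * c) * (det3 x' y z + det3 x y' z) := by
  simp only [det3_coord, PiLp.smul_apply, PiLp.add_apply, smul_eq_mul]; ring

/-- The product of two determinants is the determinant of the matrix of mutual inner products. -/
theorem det3_mul_det3 (x y z x' y' z' : E3) : det3 x y z * det3 x' y' z' =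
    inner ℝ x x' * (inner ℝ y y' * inner ℝ z z' - inner ℝ y z' * inner ℝ z y')
    - inner ℝ x y' * (inner ℝ y x' * inner ℝ z z' - inner ℝ y z' * inner ℝ z x')
    + inner ℝ x z' * (inner ℝ y x' * inner ℝ z y' - inner ℝ y y' * inner ℝ z x') := by
  simp only [det3_coord, inner_coord]; ring

/-- Lagrange's identity in the plane orthogonal to a unit vector. -/
theorem det3_mul_det3_unit {x y x' y' n : E3} (hn : ‖n‖ = 1) (hx : inner ℝ x n = 0)
    (hy : inner ℝ y n = 0) :
    det3 x y n * det3 x' y' n = inner ℝ x x' * inner ℝ y y' - inner ℝ x y' * inner ℝ y x' := by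
  have : (inner ℝ n n : ℝ) = 1 := by rw [real_inner_self_eq_norm_sq, hn]; norm_num
  rw [det3_mul_det3, hx, hy, this]; ring

/-- Two vectors orthogonal to a unit vector `n` have cross product along `n`. -/
theorem cross_eq_smul {x y n : E3} (hn : ‖n‖ = 1) (hx : inner ℝ x n = 0)
    (hy : inner ℝ y n = 0) : cross x y = det3 x y n • n := by
  have hnn : (inner ℝ n n : ℝ) = 1 := by rw [real_inner_self_eq_norm_sq, hn]; norm_num
  rw [inner_coord] at hx hy hnn
  refine E3.ext_coord ?_ ?_ ?_ <;>
    simp only [cross_zero, cross_one, cross_two, det3_coord, PiLp.smul_apply, smul_eq_mul]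
  · linear_combination (-(x 1 * y 2 - x 2 * y 1)) * hnn +
      (y 2 * n 1 - y 1 * n 2) * hx + (x 1 * n 2 - x 2 * n 1) * hy
  · linear_combination (-(x 2 * y 0 - x 0 * y 2)) * hnn +
      (y 0 * n 2 - y 2 * n 0) * hx + (x 2 * n 0 - x 0 * n 2) * hy
  · linear_combination (-(x 0 * y 1 - x 1 * y 0)) * hnn +
      (y 1 * n 0 - y 0 * n 1) * hx + (x 0 * n 1 - x 1 * n 0) * hy

theorem cross_ne_zero_iff (x y : E3) : cross x y ≠ 0 ↔ ∀ a b : ℝ, a • x + b • y = 0 → a = 0 ∧ b = 0 := by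
  have h1 : cross x y ≠ 0 ↔ crossProduct x.ofLp y.ofLp ≠ 0 := by
    simp [cross]
  rw [h1, crossProduct_ne_zero_iff_linearIndependent, LinearIndependent.pair_iff]
  refine forall₂_congr fun a b => ?_
  have : a • x.ofLp + b • y.ofLp = (a • x + b • y).ofLp := by simp
  rw [this]
  simp only [WithLp.ofLp_eq_zero]

theorem det3_ne_zero_of_unit {x y n : E3} (hn : ‖n‖ = 1) (hx : inner ℝ x n = 0)
    (hy : inner ℝ y n = 0) (hxy : cross x y ≠ 0) : det3 x y n ≠ 0 := by
  intro h
  exact hxy (by rw [cross_eq_smul hn hx hy, h, zero_smul])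

theorem cross_ne_zero_of_det3 {x y n : E3} (h : det3 x y n ≠ 0) : cross x y ≠ 0 := by
  intro h0
  rw [← inner_cross, h0, inner_zero_left] at h
  exact h rfl

theorem norm_cross_of_unit {x y n : E3} (hn : ‖n‖ = 1) (hx : inner ℝ x n = 0)
    (hy : inner ℝ y n = 0) : ‖cross x y‖ = |det3 x y n| := by
  rw [cross_eq_smul hn hx hy, norm_smul, hn, mul_one, Real.norm_eq_abs]

theorem ContDiffAt.cross {E : Type*} [NormedAddCommGroup E] [NormedSpace ℝ E] {F G : E → E3}
    {q : E} {m : WithTop ℕ∞} (hF : ContDiffAt ℝ m F q) (hG : ContDiffAt ℝ m G q) :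
    ContDiffAt ℝ m (fun x => cross (F x) (G x)) q := by
  rw [contDiffAt_euclidean] at hF hG ⊢
  have h0 := hF 0
  have h1 := hF 1
  have h2 := hF 2
  have k0 := hG 0
  have k1 := hG 1
  have k2 := hG 2
  intro i
  fin_cases i
  · simp only [Fin.zero_eta, cross_zero]; fun_prop
  · simp only [Fin.mk_one, cross_one]; fun_prop
  · simp only [Fin.reduceFinMk, cross_two]; fun_prop

theorem ContDiffAt.det3 {E : Type*} [NormedAddCommGroup E] [NormedSpace ℝ E] {F G H : E → E3}
    {q : E} {m : WithTop ℕ∞} (hF : ContDiffAt ℝ m F q) (hG : ContDiffAt ℝ m G q)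
    (hH : ContDiffAt ℝ m H q) :
    ContDiffAt ℝ m (fun x => det3 (F x) (G x) (H x)) q := by
  simp only [← inner_cross]
  exact (ContDiffAt.cross hF hG).inner ℝ hH

/-! ### The curvature formulas as pointwise linear algebra. -/

/-- The pointwise computation behind the curvature formulas. Here `a, h, c, e, b` stand for
`f_u, f_vv, f_vvv, f_uvv, f_uu` at a point of the singular curve, and `νu, νv` for the
derivatives of the unit normal `ν`. -/
theorem focal_curvature_algebra {a h c e b ν νu νv n : E3} {r : ℝ}
    (hν : ‖ν‖ = 1) (hn : ‖n‖ = 1) (haν : inner ℝ a ν = 0) (hhν : inner ℝ h ν = 0)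
    (hcν : inner ℝ c ν = -2 * inner ℝ h νv) (heν : inner ℝ e ν = -inner ℝ h νu)
    (hbν : inner ℝ b ν = -inner ℝ a νu) (haνv : inner ℝ a νv = 0)
    (han : inner ℝ a n = 0) (hνn : inner ℝ ν n = 0)
    (hA : det3 a νv ν ≠ 0) (hδ : det3 a h ν ≠ 0) (hr : r * (-det3 a νv ν) = det3 a h ν)
    (hsign : 0 < det3 a h ν * det3 a ν n) :
    (inner ℝ b n * (inner ℝ h n + 2 * r * inner ℝ νv n) - (r * inner ℝ νu n) ^ 2) /
        (inner ℝ a a * r ^ 2) =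
      -(1 / 4) * (4 * (det3 a h e / ‖cross a h‖ ^ 2 -
          det3 a h b * inner ℝ a h / (‖a‖ ^ 2 * ‖cross a h‖ ^ 2)) ^ 2 +
        (Real.sign (det3 a h ν) * det3 a b ν / ‖a‖ ^ 3) *
          (‖a‖ ^ (3 / 2 : ℝ) * det3 a h c / ‖cross a h‖ ^ (5 / 2 : ℝ)) ^ 2) ∧
    (inner ℝ a a * (inner ℝ h n + 2 * r * inner ℝ νv n) + r ^ 2 * inner ℝ b n) /
        (2 * (inner ℝ a a * r ^ 2)) =
      1 / 8 * ((‖a‖ ^ (3 / 2 : ℝ) * det3 a h c / ‖cross a h‖ ^ (5 / 2 : ℝ)) ^ 2 -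
        4 * (Real.sign (det3 a h ν) * det3 a b ν / ‖a‖ ^ 3)) := by
  set α := ‖a‖ with hα
  set D := det3 a ν n with hD
  set p : ℝ := inner ℝ h n with hp
  set w : ℝ := inner ℝ νv n with hw
  set m : ℝ := inner ℝ νu n with hm
  set β : ℝ := inner ℝ b n with hβ
  set t : ℝ := inner ℝ a νu with ht
  set k : ℝ := inner ℝ a h with hk
  have hνa : inner ℝ ν a = (0 : ℝ) := by rw [real_inner_comm, haν]
  have haa : (inner ℝ a a : ℝ) = α ^ 2 := real_inner_self_eq_norm_sq a
  have hνν : (inner ℝ ν ν : ℝ) = 1 := by rw [real_inner_self_eq_norm_sq, hν]; norm_num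
  have haν_n : cross a ν = D • n := cross_eq_smul hn han hνn
  -- As a × ν = D n with D² = |a|², every determinant containing a and ν becomes a pairing with n.
  have hmid : ∀ y : E3, det3 a y ν = -D * inner ℝ y n := by
    intro y
    rw [det3_swap_right, ← inner_cross, haν_n, real_inner_smul_left, real_inner_comm]; ring
  have hDD : D ^ 2 = α ^ 2 := by
    rw [sq, hD, det3_mul_det3_unit hn han hνn, haa, hνν, haν]; ring
  -- Both a and h are orthogonal to ν, so a × h is a multiple of ν.
  have hlast : ∀ y : E3, det3 a h y = det3 a h ν * inner ℝ y ν := by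
    intro y
    rw [← inner_cross, cross_eq_smul hν haν hhν, real_inner_smul_left, real_inner_comm]
  have hcr : ‖cross a h‖ = |det3 a h ν| := norm_cross_of_unit hν haν hhν
  have hδ' : det3 a h ν = -D * p := hmid h
  have hA' : det3 a νv ν = -D * w := hmid νv
  have hp0 : p ≠ 0 := by rintro h0; rw [hδ', h0] at hδ; simp at hδ
  have hD0 : D ≠ 0 := by rintro h0; rw [hδ', h0] at hδ; simp at hδ
  have hw0 : w ≠ 0 := by rintro h0; rw [hA', h0] at hA; simp at hA
  have hα0 : 0 < α := by
    rcases (norm_nonneg a).lt_or_eq with h0 | h0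
    · exact h0
    · exfalso; apply hD0
      have : D ^ 2 = 0 := by rw [hDD, hα, ← h0]; norm_num
      exact pow_eq_zero_iff (two_ne_zero) |>.1 this
  -- This collapses the coefficient N = p + 2rw to -p.
  have hrw : r * w = -p := by
    rw [hδ', hA'] at hr
    apply mul_left_cancel₀ hD0
    linarith
  -- Since det(a, h, ν) = -D p, the sign hypothesis reads -D² p > 0.
  have hpneg : p < 0 := by
    rw [hδ'] at hsign
    have : 0 < D ^ 2 := by positivity
    nlinarith
  have h1 : inner ℝ h νv = p * w := by
    have := det3_mul_det3_unit (x' := a) (y' := νv) hν haν hhν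
    rw [hδ', hA', haa, haνv] at this
    have h2 : α ^ 2 * (p * w) = α ^ 2 * inner ℝ h νv := by
      rw [← hDD] at this ⊢; linarith
    exact (mul_left_cancel₀ (by positivity) h2).symm
  -- The components of h and ν_u along a and n; the a-part tk/α² is what the correction term of κ_t
  -- cancels.
  have h2 : inner ℝ h νu = p * m + t * k / α ^ 2 := by
    have := det3_mul_det3_unit (x' := a) (y' := νu) hν haν hhν
    rw [hδ', hmid νu, haa, real_inner_comm a h] at this
    have h2 : α ^ 2 * (p * m + t * k / α ^ 2) = α ^ 2 * inner ℝ h νu := by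
      rw [mul_add, mul_div_cancel₀ _ (by positivity : α ^ 2 ≠ 0)]
      rw [← hDD] at this ⊢; linarith
    exact (mul_left_cancel₀ (by positivity) h2).symm
  have hκt : det3 a h e / ‖cross a h‖ ^ 2 - det3 a h b * k / (α ^ 2 * ‖cross a h‖ ^ 2) = m / D := by
    rw [hlast e, hlast b, hcr, sq_abs, heν, hbν, h2, hδ']
    field_simp
    ring
  have hb' : det3 a b ν = -D * β := hmid b
  have hc' : det3 a h c = -D * p * (-2 * (p * w)) := by rw [hlast c, hcν, h1, hδ']
  clear_value α D p w m β t k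
  -- D = ±α, and since p < 0 the sign of λ_v = -D p is that of D.
  have hκs : Real.sign (det3 a h ν) * det3 a b ν / α ^ 3 = -β / α ^ 2 := by
    rw [hb', hδ']
    rcases eq_or_eq_neg_of_sq_eq_sq _ _ hDD with h3 | h3
    · rw [h3, Real.sign_of_pos (by have := mul_pos hα0 (neg_pos.2 hpneg); linarith)]; field_simp
    · rw [h3, Real.sign_of_neg (by have := mul_pos hα0 (neg_pos.2 hpneg); linarith)]; field_simp
  -- Only κ_c² occurs, so squaring removes the half-integer exponents; |det(a, h, ν)| = -α p.
  have hκc : (α ^ (3 / 2 : ℝ) * det3 a h c / ‖cross a h‖ ^ (5 / 2 : ℝ)) ^ 2 = -4 * w ^ 2 / p := by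
    have e1 : (α ^ (3 / 2 : ℝ)) ^ 2 = α ^ 3 := by
      rw [← Real.rpow_natCast, ← Real.rpow_mul hα0.le, ← Real.rpow_natCast]; norm_num
    have e2 : ((α * -p) ^ (5 / 2 : ℝ)) ^ 2 = (α * -p) ^ 5 := by
      have : 0 ≤ α * -p := mul_nonneg hα0.le (neg_pos.2 hpneg).le
      rw [← Real.rpow_natCast, ← Real.rpow_mul this, ← Real.rpow_natCast]; norm_num
    have e3 : |det3 a h ν| = α * -p := by
      rw [hδ', abs_mul, abs_neg, abs_of_neg hpneg]
      congr 1
      rw [← abs_of_pos hα0]; exact (sq_eq_sq_iff_abs_eq_abs _ _).1 hDD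
    rw [hcr, e3, div_pow, mul_pow, e1, e2, hc', div_eq_div_iff _ hp0]
    · linear_combination (4 * α ^ 3 * p ^ 5 * w ^ 2) * hDD
    · have : α * -p ≠ 0 := mul_ne_zero hα0.ne' (neg_ne_zero.2 hp0)
      positivity
  have hr' : r = -p / w := by rw [← hrw]; field_simp
  rw [hκt, hκs, hκc, haa, hr', div_pow m D, hDD]
  constructor
  · field_simp
    ring
  · field_simp
    ring
-- Partial derivatives and the chain rule.
section Calculus

variable {E : Type*} [NormedAddCommGroup E] [NormedSpace ℝ E]

theorem contDiffAt_fderiv_apply {F : ℝ × ℝ → E} {q : ℝ × ℝ} (hF : ContDiffAt ℝ ∞ F q)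
    (X : ℝ × ℝ) : ContDiffAt ℝ ∞ (fun x => fderiv ℝ F x X) q :=
  (hF.fderiv_right (m := ∞) (by simp)).clm_apply contDiffAt_const

theorem contDiffAt_du {F : ℝ × ℝ → E} {q : ℝ × ℝ} (hF : ContDiffAt ℝ ∞ F q) :
    ContDiffAt ℝ ∞ (du F) q := contDiffAt_fderiv_apply hF _

theorem contDiffAt_dv {F : ℝ × ℝ → E} {q : ℝ × ℝ} (hF : ContDiffAt ℝ ∞ F q) :
    ContDiffAt ℝ ∞ (dv F) q := contDiffAt_fderiv_apply hF _

theorem ContDiffAt.differentiableAt_top {F : ℝ × ℝ → E} {q : ℝ × ℝ}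
    (hF : ContDiffAt ℝ ∞ F q) : DifferentiableAt ℝ F q :=
  hF.differentiableAt (by simp)

theorem fderiv_apply_eq (F : ℝ × ℝ → E) (q X : ℝ × ℝ) :
    fderiv ℝ F q X = X.1 • du F q + X.2 • dv F q := by
  have : X = X.1 • ((1, 0) : ℝ × ℝ) + X.2 • ((0, 1) : ℝ × ℝ) := by simp
  conv_lhs => rw [this, map_add, map_smul, map_smul]
  rfl

theorem dv_du {F : ℝ × ℝ → E} {q : ℝ × ℝ} (hF : ContDiffAt ℝ ∞ F q) :
    dv (du F) q = du (dv F) q := by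
  have hd : DifferentiableAt ℝ (fderiv ℝ F) q :=
    (hF.fderiv_right (m := ∞) (by simp)).differentiableAt (by simp)
  have key : ∀ X Y : ℝ × ℝ,
      fderiv ℝ (fun x => fderiv ℝ F x X) q Y = fderiv ℝ (fderiv ℝ F) q Y X := by
    intro X Y
    rw [fderiv_clm_apply hd (by fun_prop)]
    simp
  have hs : IsSymmSndFDerivAt ℝ F q := hF.isSymmSndFDerivAt (by simpa using (by exact_mod_cast le_top : ((2 : ℕ∞) : WithTop ℕ∞) ≤ ∞))
  change fderiv ℝ (fun x => fderiv ℝ F x (1, 0)) q (0, 1) =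
    fderiv ℝ (fun x => fderiv ℝ F x (0, 1)) q (1, 0)
  rw [key, key]
  exact hs _ _

theorem fderiv_comp_eq {F : ℝ × ℝ → E} {φ : ℝ × ℝ → ℝ × ℝ} {x : ℝ × ℝ}
    (hF : DifferentiableAt ℝ F (φ x)) (hφ : DifferentiableAt ℝ φ x) (X : ℝ × ℝ) :
    fderiv ℝ (F ∘ φ) x X = fderiv ℝ F (φ x) (fderiv ℝ φ x X) := by
  rw [fderiv_comp x hF hφ]; rfl

theorem du_comp {F : ℝ × ℝ → E} {φ : ℝ × ℝ → ℝ × ℝ} {x : ℝ × ℝ}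
    (hF : DifferentiableAt ℝ F (φ x)) (hφ : DifferentiableAt ℝ φ x) :
    du (F ∘ φ) x = (du φ x).1 • du F (φ x) + (du φ x).2 • dv F (φ x) := by
  rw [du, fderiv_comp_eq hF hφ, fderiv_apply_eq]; rfl

theorem dv_comp {F : ℝ × ℝ → E} {φ : ℝ × ℝ → ℝ × ℝ} {x : ℝ × ℝ}
    (hF : DifferentiableAt ℝ F (φ x)) (hφ : DifferentiableAt ℝ φ x) :
    dv (F ∘ φ) x = (dv φ x).1 • du F (φ x) + (dv φ x).2 • dv F (φ x) := by
  rw [dv, fderiv_comp_eq hF hφ, fderiv_apply_eq]; rfl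

theorem fderiv_smul_apply_eq {ρ : ℝ × ℝ → ℝ} {F : ℝ × ℝ → E} {q : ℝ × ℝ}
    (hρ : DifferentiableAt ℝ ρ q) (hF : DifferentiableAt ℝ F q) (X : ℝ × ℝ) :
    fderiv ℝ (fun x => ρ x • F x) q X = ρ q • fderiv ℝ F q X + fderiv ℝ ρ q X • F q := by
  rw [fderiv_fun_smul hρ hF]; simp

theorem fderiv_mul_apply_eq {ρ σ : ℝ × ℝ → ℝ} {q : ℝ × ℝ}
    (hρ : DifferentiableAt ℝ ρ q) (hσ : DifferentiableAt ℝ σ q) (X : ℝ × ℝ) :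
    fderiv ℝ (fun x => ρ x * σ x) q X = ρ q * fderiv ℝ σ q X + fderiv ℝ ρ q X * σ q := by
  rw [fderiv_fun_mul hρ hσ]; simp [mul_comm]

/-- The derivative along the `u`-axis of a function vanishing there. -/
theorem du_eq_zero_of_axis {F : ℝ × ℝ → E} {u : ℝ} (hF : DifferentiableAt ℝ F (u, 0))
    (h0 : ∀ᶠ t in 𝓝 u, F (t, 0) = 0) : du F (u, 0) = 0 := by
  have h1 : HasDerivAt (fun t : ℝ => ((t, 0) : ℝ × ℝ)) (1, 0) u :=
    (hasDerivAt_id u).prodMk (hasDerivAt_const u 0)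
  have h2 : HasDerivAt (fun t : ℝ => F (t, 0)) (fderiv ℝ F (u, 0) (1, 0)) u :=
    HasFDerivAt.comp_hasDerivAt (f := fun t : ℝ => ((t, 0) : ℝ × ℝ)) u hF.hasFDerivAt h1
  have h3 : HasDerivAt (fun t : ℝ => F (t, 0)) 0 u :=
    (hasDerivAt_const u (0 : E)).congr_of_eventuallyEq h0
  exact h2.unique h3

end Calculus

/-! ### The densities λ, 2λH and λK under coordinate changes. -/

/-- The Jacobian determinant of a coordinate change. -/
noncomputable def jac (φ : ℝ × ℝ → ℝ × ℝ) (x : ℝ × ℝ) : ℝ :=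
  (du φ x).1 * (dv φ x).2 - (du φ x).2 * (dv φ x).1

/-- The density `2 λ H`. -/
noncomputable def mixedArea (F n : ℝ × ℝ → E3) (q : ℝ × ℝ) : ℝ :=
  -(det3 (du n q) (dv F q) (n q) + det3 (du F q) (dv n q) (n q))

/-- The density `λ K`. -/
noncomputable def normalArea (n : ℝ × ℝ → E3) (q : ℝ × ℝ) : ℝ := det3 (du n q) (dv n q) (n q)

section Densities

variable {F n : ℝ × ℝ → E3} {φ : ℝ × ℝ → ℝ × ℝ} {x : ℝ × ℝ}

theorem signedArea_comp (hF : DifferentiableAt ℝ F (φ x)) (hφ : DifferentiableAt ℝ φ x) :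
    signedArea (F ∘ φ) (n ∘ φ) x = jac φ x * signedArea F n (φ x) := by
  rw [signedArea, du_comp hF hφ, dv_comp hF hφ, det3_change]; rfl

theorem mixedArea_comp (hF : DifferentiableAt ℝ F (φ x)) (hn : DifferentiableAt ℝ n (φ x))
    (hφ : DifferentiableAt ℝ φ x) :
    mixedArea (F ∘ φ) (n ∘ φ) x = jac φ x * mixedArea F n (φ x) := by
  rw [mixedArea, du_comp hF hφ, dv_comp hF hφ, du_comp hn hφ, dv_comp hn hφ,
    det3_change_polarized, mixedArea, jac, Function.comp_apply, mul_neg]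

theorem normalArea_comp (hn : DifferentiableAt ℝ n (φ x)) (hφ : DifferentiableAt ℝ φ x) :
    normalArea (n ∘ φ) x = jac φ x * normalArea n (φ x) := by
  rw [normalArea, du_comp hn hφ, dv_comp hn hφ, det3_change]; rfl

end Densities

theorem contDiffAt_signedArea {F n : ℝ × ℝ → E3} {q : ℝ × ℝ} (hF : ContDiffAt ℝ ∞ F q)
    (hn : ContDiffAt ℝ ∞ n q) : ContDiffAt ℝ ∞ (signedArea F n) q :=
  ContDiffAt.det3 (contDiffAt_du hF) (contDiffAt_dv hF) hn

theorem contDiffAt_mixedArea {F n : ℝ × ℝ → E3} {q : ℝ × ℝ} (hF : ContDiffAt ℝ ∞ F q)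
    (hn : ContDiffAt ℝ ∞ n q) : ContDiffAt ℝ ∞ (mixedArea F n) q :=
  ((ContDiffAt.det3 (contDiffAt_du hn) (contDiffAt_dv hF) hn).add
    (ContDiffAt.det3 (contDiffAt_du hF) (contDiffAt_dv hn) hn)).neg

theorem contDiffAt_normalArea {n : ℝ × ℝ → E3} {q : ℝ × ℝ}
    (hn : ContDiffAt ℝ ∞ n q) : ContDiffAt ℝ ∞ (normalArea n) q :=
  ContDiffAt.det3 (contDiffAt_du hn) (contDiffAt_dv hn) hn

theorem contDiffAt_jac {φ : ℝ × ℝ → ℝ × ℝ} {x : ℝ × ℝ} (hφ : ContDiffAt ℝ ∞ φ x) :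
    ContDiffAt ℝ ∞ (jac φ) x := by
  have h1 := contDiffAt_du hφ
  have h2 := contDiffAt_dv hφ
  unfold jac
  fun_prop

/-! ### Fundamental forms and curvatures of a map with a unit normal. -/

/-- A smooth map on an open set together with a smooth unit normal field. -/
structure IsNormalPair (F n : ℝ × ℝ → E3) (S : Set (ℝ × ℝ)) : Prop where
  isOpen : IsOpen S
  smooth : ContDiffOn ℝ ∞ F S
  normal : IsUnitNormalOn F n S

namespace IsNormalPair

variable {F n : ℝ × ℝ → E3} {S : Set (ℝ × ℝ)} {q : ℝ × ℝ}

theorem contDiffAt (h : IsNormalPair F n S) (hq : q ∈ S) : ContDiffAt ℝ ∞ F q :=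
  h.smooth.contDiffAt (h.isOpen.mem_nhds hq)

theorem contDiffAt_normal (h : IsNormalPair F n S) (hq : q ∈ S) : ContDiffAt ℝ ∞ n q :=
  h.normal.smooth.contDiffAt (h.isOpen.mem_nhds hq)

theorem inner_du (h : IsNormalPair F n S) (hq : q ∈ S) : inner ℝ (du F q) (n q) = 0 :=
  h.normal.orthogonal q hq _

theorem inner_dv (h : IsNormalPair F n S) (hq : q ∈ S) : inner ℝ (dv F q) (n q) = 0 :=
  h.normal.orthogonal q hq _

/-- Differentiating an orthogonality relation `⟨F, G⟩ = 0`. -/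
theorem _root_.FocalSurface.inner_fderiv_of_inner_eq_zero {F G : ℝ × ℝ → E3} {q : ℝ × ℝ} {c : ℝ}
    (hF : ContDiffAt ℝ ∞ F q) (hG : ContDiffAt ℝ ∞ G q)
    (h0 : ∀ᶠ x in 𝓝 q, inner ℝ (F x) (G x) = c) (X : ℝ × ℝ) :
    inner ℝ (fderiv ℝ F q X) (G q) = -inner ℝ (F q) (fderiv ℝ G q X) := by
  have h1 : fderiv ℝ (fun x => (inner ℝ (F x) (G x) : ℝ)) q X = 0 := by
    have : (fun x => (inner ℝ (F x) (G x) : ℝ)) =ᶠ[𝓝 q] fun _ => c := h0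
    rw [this.fderiv_eq]; simp
  rw [fderiv_inner_apply ℝ hF.differentiableAt_top hG.differentiableAt_top] at h1
  linarith

theorem eventually_mem (h : IsNormalPair F n S) (hq : q ∈ S) : ∀ᶠ x in 𝓝 q, x ∈ S :=
  h.isOpen.mem_nhds hq

/-- Differentiating ⟨dF, n⟩ = 0 trades second derivatives of F for first derivatives of n. -/
theorem inner_fderiv_fderiv (h : IsNormalPair F n S) (hq : q ∈ S) (X Y : ℝ × ℝ) :
    inner ℝ (fderiv ℝ (fun x => fderiv ℝ F x X) q Y) (n q) =
      -inner ℝ (fderiv ℝ F q X) (fderiv ℝ n q Y) :=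
  inner_fderiv_of_inner_eq_zero (contDiffAt_fderiv_apply (h.contDiffAt hq) X)
    (h.contDiffAt_normal hq)
    ((h.eventually_mem hq).mono fun x hx => h.normal.orthogonal x hx X) Y

theorem inner_normal_fderiv (h : IsNormalPair F n S) (hq : q ∈ S) (X : ℝ × ℝ) :
    inner ℝ (fderiv ℝ n q X) (n q) = 0 := by
  have := inner_fderiv_of_inner_eq_zero (c := 1) (h.contDiffAt_normal hq) (h.contDiffAt_normal hq)
    ((h.eventually_mem hq).mono fun x hx => by
      rw [real_inner_self_eq_norm_sq, h.normal.norm_eq_one x hx]; norm_num) X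
  rw [real_inner_comm (fderiv ℝ n q X)] at this
  linarith [real_inner_comm (fderiv ℝ n q X) (n q)]

/-- Both sides equal -⟨F_uv, n⟩ by symmetry of second derivatives; no regularity of F is needed. -/
theorem inner_du_dv_comm (h : IsNormalPair F n S) (hq : q ∈ S) :
    inner ℝ (du F q) (dv n q) = inner ℝ (dv F q) (du n q) := by
  have h1 := h.inner_fderiv_fderiv hq (1, 0) (0, 1)
  have h2 := h.inner_fderiv_fderiv hq (0, 1) (1, 0)
  have h3 : fderiv ℝ (fun x => fderiv ℝ F x (1, 0)) q (0, 1) =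
    fderiv ℝ (fun x => fderiv ℝ F x (0, 1)) q (1, 0) := dv_du (h.contDiffAt hq)
  rw [h3, h2] at h1
  exact (neg_inj.1 h1).symm

theorem signedArea_sq (h : IsNormalPair F n S) (hq : q ∈ S) :
    signedArea F n q ^ 2 = coeffE F q * coeffG F q - coeffF F q ^ 2 := by
  rw [sq, signedArea, det3_mul_det3_unit (h.normal.norm_eq_one q hq) (h.inner_du hq)
    (h.inner_dv hq), coeffE, coeffF, coeffG, real_inner_comm (du F q) (dv F q)]
  ring

/-- Lagrange's identity gives LN - M² = λ · λK and EG - F² = λ², leaving a quotient of two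
densities. -/
theorem gaussCurv_eq (h : IsNormalPair F n S) (hq : q ∈ S) :
    gaussCurv F n q = normalArea n q / signedArea F n q := by
  have hL : coeffL F n q = -inner ℝ (du F q) (du n q) := h.inner_fderiv_fderiv hq (1, 0) (1, 0)
  have hM : coeffM F n q = -inner ℝ (du F q) (dv n q) := h.inner_fderiv_fderiv hq (1, 0) (0, 1)
  have hN : coeffN F n q = -inner ℝ (dv F q) (dv n q) := h.inner_fderiv_fderiv hq (0, 1) (0, 1)
  have h1 := det3_mul_det3_unit (x' := du n q) (y' := dv n q) (h.normal.norm_eq_one q hq)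
    (h.inner_du hq) (h.inner_dv hq)
  rw [← h.inner_du_dv_comm hq] at h1
  have h2 : coeffL F n q * coeffN F n q - coeffM F n q ^ 2 =
      signedArea F n q * normalArea n q := by
    rw [hL, hM, hN, signedArea, normalArea, h1]; ring
  rw [gaussCurv, h2, ← h.signedArea_sq hq]
  -- Where λ = 0 both sides are 0, as division by zero yields 0.
  rcases eq_or_ne (signedArea F n q) 0 with h0 | h0
  · simp [h0]
  · field_simp

theorem meanCurv_eq (h : IsNormalPair F n S) (hq : q ∈ S) :
    meanCurv F n q = mixedArea F n q / (2 * signedArea F n q) := by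
  have hL : coeffL F n q = -inner ℝ (du F q) (du n q) := h.inner_fderiv_fderiv hq (1, 0) (1, 0)
  have hM : coeffM F n q = -inner ℝ (du F q) (dv n q) := h.inner_fderiv_fderiv hq (1, 0) (0, 1)
  have hN : coeffN F n q = -inner ℝ (dv F q) (dv n q) := h.inner_fderiv_fderiv hq (0, 1) (0, 1)
  have h1 := det3_mul_det3_unit (x' := du n q) (y' := dv F q) (h.normal.norm_eq_one q hq)
    (h.inner_du hq) (h.inner_dv hq)
  have h2 := det3_mul_det3_unit (x' := du F q) (y' := dv n q) (h.normal.norm_eq_one q hq)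
    (h.inner_du hq) (h.inner_dv hq)
  rw [← h.inner_du_dv_comm hq] at h1
  rw [real_inner_comm (du F q) (dv F q)] at h2
  have h2 : coeffE F q * coeffN F n q - 2 * coeffF F q * coeffM F n q
      + coeffG F q * coeffL F n q = signedArea F n q * mixedArea F n q := by
    rw [hL, hM, hN, mixedArea, signedArea, coeffE, coeffF, coeffG]
    linear_combination h1 + h2
  rw [meanCurv, h2, ← h.signedArea_sq hq]
  rcases eq_or_ne (signedArea F n q) 0 with h0 | h0
  · simp [h0]
  · field_simp

theorem signedArea_ne_zero_iff (h : IsNormalPair F n S) (hq : q ∈ S) :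
    signedArea F n q ≠ 0 ↔ q ∈ regularSet F := by
  have h1 : q ∈ regularSet F ↔ cross (du F q) (dv F q) ≠ 0 := by
    rw [regularSet, Set.mem_ofPred_eq, cross_ne_zero_iff, injective_iff_map_eq_zero]
    simp only [fderiv_apply_eq F q, Prod.forall, Prod.mk_eq_zero]
  rw [h1]
  exact ⟨cross_ne_zero_of_det3, det3_ne_zero_of_unit (h.normal.norm_eq_one q hq) (h.inner_du hq)
    (h.inner_dv hq)⟩

/-- Restricting to a smaller domain and changing coordinates. -/
theorem comp (h : IsNormalPair F n S) {φ : ℝ × ℝ → ℝ × ℝ} {W : Set (ℝ × ℝ)} (hW : IsOpen W)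
    (hφ : ContDiffOn ℝ ∞ φ W) (hWS : Set.MapsTo φ W S) : IsNormalPair (F ∘ φ) (n ∘ φ) W where
  isOpen := hW
  smooth := h.smooth.comp hφ hWS
  normal :=
    { smooth := h.normal.smooth.comp hφ hWS
      norm_eq_one := fun x hx => h.normal.norm_eq_one _ (hWS hx)
      orthogonal := fun x hx X => by
        rw [fderiv_comp_eq (h.contDiffAt (hWS hx)).differentiableAt_top
          (hφ.contDiffAt (hW.mem_nhds hx)).differentiableAt_top]
        exact h.normal.orthogonal _ (hWS hx) _ }

/-- Numerator and denominator each gain one Jacobian factor, so second derivatives of φ never enter.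
-/
theorem gaussCurv_comp (h : IsNormalPair F n S) {φ : ℝ × ℝ → ℝ × ℝ} {W : Set (ℝ × ℝ)}
    (hW : IsOpen W) (hφ : ContDiffOn ℝ ∞ φ W) (hWS : Set.MapsTo φ W S) {x : ℝ × ℝ} (hx : x ∈ W)
    (hJ : jac φ x ≠ 0) : gaussCurv (F ∘ φ) (n ∘ φ) x = gaussCurv F n (φ x) := by
  have hF := (h.contDiffAt (hWS hx)).differentiableAt_top
  have hn := (h.contDiffAt_normal (hWS hx)).differentiableAt_top
  have hφ' := (hφ.contDiffAt (hW.mem_nhds hx)).differentiableAt_top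
  rw [(h.comp hW hφ hWS).gaussCurv_eq hx, h.gaussCurv_eq (hWS hx), signedArea_comp hF hφ',
    normalArea_comp hn hφ', mul_div_mul_left _ _ hJ]

theorem meanCurv_comp (h : IsNormalPair F n S) {φ : ℝ × ℝ → ℝ × ℝ} {W : Set (ℝ × ℝ)}
    (hW : IsOpen W) (hφ : ContDiffOn ℝ ∞ φ W) (hWS : Set.MapsTo φ W S) {x : ℝ × ℝ} (hx : x ∈ W)
    (hJ : jac φ x ≠ 0) : meanCurv (F ∘ φ) (n ∘ φ) x = meanCurv F n (φ x) := by
  have hF := (h.contDiffAt (hWS hx)).differentiableAt_top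
  have hn := (h.contDiffAt_normal (hWS hx)).differentiableAt_top
  have hφ' := (hφ.contDiffAt (hW.mem_nhds hx)).differentiableAt_top
  rw [(h.comp hW hφ hWS).meanCurv_eq hx, h.meanCurv_eq (hWS hx), signedArea_comp hF hφ',
    mixedArea_comp hF hn hφ', mul_left_comm, mul_div_mul_left _ _ hJ]

end IsNormalPair

theorem meanCurv_neg (F n : ℝ × ℝ → E3) (q : ℝ × ℝ) :
    meanCurv F (-n) q = -meanCurv F n q := by
  simp only [meanCurv, coeffL, coeffM, coeffN, Pi.neg_apply, inner_neg_right]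
  ring

/-- A chart with smooth inverse has nonvanishing Jacobian. -/
theorem jac_ne_zero {φ : OpenPartialHomeomorph (ℝ × ℝ) (ℝ × ℝ)}
    (hφ : ContDiffOn ℝ ∞ φ φ.source) (hφ' : ContDiffOn ℝ ∞ φ.symm φ.target) {x : ℝ × ℝ}
    (hx : x ∈ φ.source) : jac φ x ≠ 0 := by
  have h1 := (hφ.contDiffAt (φ.open_source.mem_nhds hx)).differentiableAt_top
  have h2 := (hφ'.contDiffAt (φ.open_target.mem_nhds (φ.map_source hx))).differentiableAt_top
  have h3 : (φ.symm ∘ φ) =ᶠ[𝓝 x] id :=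
    Filter.eventuallyEq_of_mem (φ.open_source.mem_nhds hx) fun y hy => φ.left_inv hy
  have e1 : du (φ.symm ∘ φ) x = (1, 0) := by rw [du, h3.fderiv_eq]; simp
  have e2 : dv (φ.symm ∘ φ) x = (0, 1) := by rw [dv, h3.fderiv_eq]; simp
  rw [du_comp h2 h1] at e1
  rw [dv_comp h2 h1] at e2
  simp only [Prod.ext_iff, Prod.fst_add, Prod.snd_add, Prod.smul_fst, Prod.smul_snd,
    smul_eq_mul] at e1 e2
  intro h0
  rw [jac] at h0
  set a := (du φ x).1
  set b := (du φ x).2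
  set c := (dv φ x).1
  set d := (dv φ x).2
  set X := du φ.symm (φ x)
  set Y := dv φ.symm (φ x)
  have : (a * d - b * c) * (X.1 * Y.2 - X.2 * Y.1) = 1 := by
    obtain ⟨e11, e12⟩ := e1
    obtain ⟨e21, e22⟩ := e2
    linear_combination e11 * (c * X.2 + d * Y.2) - e12 * (c * X.1 + d * Y.1) + e22
  rw [h0, zero_mul] at this
  exact zero_ne_one this

/-- Applied to ⟨g_vv, ν⟩ = -⟨g_v, ν_v⟩ and its mixed analogue, it yields the normal components of
g_vvv and g_uvv. -/
theorem inner_fderiv_of_inner_eq_neg {P Q R T : ℝ × ℝ → E3} {q : ℝ × ℝ}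
    (hP : ContDiffAt ℝ ∞ P q) (hQ : ContDiffAt ℝ ∞ Q q) (hR : ContDiffAt ℝ ∞ R q)
    (hT : ContDiffAt ℝ ∞ T q)
    (h0 : ∀ᶠ x in 𝓝 q, (inner ℝ (P x) (Q x) : ℝ) = -inner ℝ (R x) (T x)) (X : ℝ × ℝ) :
    (inner ℝ (fderiv ℝ P q X) (Q q) + inner ℝ (P q) (fderiv ℝ Q q X) : ℝ) =
      -(inner ℝ (fderiv ℝ R q X) (T q) + inner ℝ (R q) (fderiv ℝ T q X)) := by
  have h1 : (fun x => (inner ℝ (P x) (Q x) : ℝ)) =ᶠ[𝓝 q] fun x => -inner ℝ (R x) (T x) := h0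
  have h2 := congrArg (fun D : ℝ × ℝ →L[ℝ] ℝ => D X) h1.fderiv_eq
  simp only [fderiv_fun_neg, neg_apply] at h2
  rw [fderiv_inner_apply ℝ hP.differentiableAt_top hQ.differentiableAt_top,
    fderiv_inner_apply ℝ hR.differentiableAt_top hT.differentiableAt_top] at h2
  linarith

/-! ### Derivatives of g + ρν. -/

section ParallelSurface

variable {g ν : ℝ × ℝ → E3} {ρ : ℝ × ℝ → ℝ} {q : ℝ × ℝ}

theorem fderiv_add_smul (hg : ContDiffAt ℝ ∞ g q) (hν : ContDiffAt ℝ ∞ ν q)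
    (hρ : ContDiffAt ℝ ∞ ρ q) (X : ℝ × ℝ) :
    fderiv ℝ (fun x => g x + ρ x • ν x) q X =
      fderiv ℝ g q X + (ρ q • fderiv ℝ ν q X + fderiv ℝ ρ q X • ν q) := by
  rw [fderiv_fun_add hg.differentiableAt_top
    (hρ.differentiableAt_top.fun_smul hν.differentiableAt_top), add_apply,
    fderiv_smul_apply_eq hρ.differentiableAt_top hν.differentiableAt_top]

/-- Second derivatives of `g + ρ ν` at a zero of `ρ`, paired with a vector orthogonal to `ν`. -/
theorem inner_fderiv_fderiv_add_smul {W : Set (ℝ × ℝ)} (hW : IsOpen W)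
    (hg : ContDiffOn ℝ ∞ g W) (hν : ContDiffOn ℝ ∞ ν W) (hρ : ContDiffOn ℝ ∞ ρ W) (hq : q ∈ W)
    (h0 : ρ q = 0) {m : E3} (hm : inner ℝ (ν q) m = 0) (X Y : ℝ × ℝ) :
    (inner ℝ (fderiv ℝ (fun y => fderiv ℝ (fun x => g x + ρ x • ν x) y X) q Y) m : ℝ) =
      inner ℝ (fderiv ℝ (fun y => fderiv ℝ g y X) q Y) m +
        fderiv ℝ ρ q Y * inner ℝ (fderiv ℝ ν q X) m +
        fderiv ℝ ρ q X * inner ℝ (fderiv ℝ ν q Y) m := by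
  have hg' : ∀ y ∈ W, ContDiffAt ℝ ∞ g y := fun y hy => hg.contDiffAt (hW.mem_nhds hy)
  have hν' : ∀ y ∈ W, ContDiffAt ℝ ∞ ν y := fun y hy => hν.contDiffAt (hW.mem_nhds hy)
  have hρ' : ∀ y ∈ W, ContDiffAt ℝ ∞ ρ y := fun y hy => hρ.contDiffAt (hW.mem_nhds hy)
  have h1 : (fun y => fderiv ℝ (fun x => g x + ρ x • ν x) y X) =ᶠ[𝓝 q]
      fun y => fderiv ℝ g y X + (ρ y • fderiv ℝ ν y X + fderiv ℝ ρ y X • ν y) :=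
    Filter.eventuallyEq_of_mem (hW.mem_nhds hq) fun y hy =>
      fderiv_add_smul (hg' y hy) (hν' y hy) (hρ' y hy) X
  have dg := (contDiffAt_fderiv_apply (hg' q hq) X).differentiableAt_top
  have dν := (contDiffAt_fderiv_apply (hν' q hq) X).differentiableAt_top
  have dρ := (contDiffAt_fderiv_apply (hρ' q hq) X).differentiableAt_top
  have eν := (hν' q hq).differentiableAt_top
  have eρ := (hρ' q hq).differentiableAt_top
  rw [h1.fderiv_eq, fderiv_fun_add dg ((eρ.fun_smul dν).fun_add (dρ.fun_smul eν)),
    fderiv_fun_add (eρ.fun_smul dν) (dρ.fun_smul eν)]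
  simp only [add_apply, fderiv_smul_apply_eq eρ dν, fderiv_smul_apply_eq dρ eν,
    inner_add_left, real_inner_smul_left, h0, hm]
  ring

end ParallelSurface

/-! ### Curvatures of g + ρν along the singular curve. -/

section AdaptedCoordinates

variable {g ν : ℝ × ℝ → E3} {W : Set (ℝ × ℝ)} {u : ℝ}

theorem signedArea_eq_zero_of_dv {q : ℝ × ℝ} (h : dv g q = 0) : signedArea g ν q = 0 := by
  rw [signedArea, h, det3_zero_mid]

/-- Because g_v = 0 at the point, only the term in which the derivative hits g_v survives. -/
theorem dv_signedArea (hg : IsNormalPair g ν W) (hu : (u, 0) ∈ W) (hnull : dv g (u, 0) = 0) :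
    dv (signedArea g ν) (u, 0) = det3 (du g (u, 0)) (dv (dv g) (u, 0)) (ν (u, 0)) := by
  have h1 : signedArea g ν = fun x => inner ℝ (dv g x) (cross (ν x) (du g x)) := by
    funext x; rw [signedArea, det3_eq_inner_mid]
  have hc := ContDiffAt.cross (hg.contDiffAt_normal hu) (contDiffAt_du (hg.contDiffAt hu))
  rw [h1, dv, fderiv_inner_apply ℝ (contDiffAt_dv (hg.contDiffAt hu)).differentiableAt_top
    hc.differentiableAt_top, hnull, inner_zero_left, zero_add, det3_eq_inner_mid]
  rfl

theorem mixedArea_of_dv {q : ℝ × ℝ} (h : dv g q = 0) :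
    mixedArea g ν q = -det3 (du g q) (dv ν q) (ν q) := by
  rw [mixedArea, h, det3_zero_mid, zero_add]

theorem eventually_axis (hW : IsOpen W) (hu : (u, 0) ∈ W) : ∀ᶠ t : ℝ in 𝓝 u, (t, 0) ∈ W :=
  (Continuous.prodMk_left (0 : ℝ)).continuousAt.eventually (hW.mem_nhds hu)

theorem du_add_smul_on_axis (hg : IsNormalPair g ν W) (hu : (u, 0) ∈ W) {ρ : ℝ × ℝ → ℝ}
    (hρ : ContDiffOn ℝ ∞ ρ W) (hρ0 : ∀ t : ℝ, (t, 0) ∈ W → ρ (t, 0) = 0) :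
    du (fun x => g x + ρ x • ν x) (u, 0) = du g (u, 0) := by
  have sρ : ContDiffAt ℝ ∞ ρ (u, 0) := hρ.contDiffAt (hg.isOpen.mem_nhds hu)
  have hρu : du ρ (u, 0) = 0 := du_eq_zero_of_axis sρ.differentiableAt_top
    ((eventually_axis hg.isOpen hu).mono fun t ht => hρ0 t ht)
  rw [du, fderiv_add_smul (hg.contDiffAt hu) (hg.contDiffAt_normal hu) sρ, hρ0 u hu,
    show fderiv ℝ ρ (u, 0) (1, 0) = 0 from hρu]
  simp [du]

theorem dv_add_smul_on_axis (hg : IsNormalPair g ν W) (hu : (u, 0) ∈ W)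
    (hnull : dv g (u, 0) = 0) {ρ : ℝ × ℝ → ℝ}
    (hρ : ContDiffOn ℝ ∞ ρ W) (hρ0 : ρ (u, 0) = 0) :
    dv (fun x => g x + ρ x • ν x) (u, 0) = dv ρ (u, 0) • ν (u, 0) := by
  have sρ : ContDiffAt ℝ ∞ ρ (u, 0) := hρ.contDiffAt (hg.isOpen.mem_nhds hu)
  rw [dv, fderiv_add_smul (hg.contDiffAt hu) (hg.contDiffAt_normal hu) sρ, hρ0,
    show fderiv ℝ g (u, 0) (0, 1) = 0 from hnull]
  simp [dv]

/-- Gaussian and mean curvature of `g + ρ ν` on the singular curve of `g`, where `ρ` vanishes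
and `ρ_v` is the ratio of `λ_v` and `2 λ H`. -/
theorem curvatures_on_axis (hg : IsNormalPair g ν W) (hu : (u, 0) ∈ W)
    (hnull : ∀ t : ℝ, (t, 0) ∈ W → dv g (t, 0) = 0) {ρ : ℝ × ℝ → ℝ} {n : ℝ × ℝ → E3}
    (hρ : ContDiffOn ℝ ∞ ρ W) (hn : IsNormalPair (fun x => g x + ρ x • ν x) n W)
    (hρ0 : ∀ t : ℝ, (t, 0) ∈ W → ρ (t, 0) = 0)
    (hδ : dv (signedArea g ν) (u, 0) ≠ 0) (hA : mixedArea g ν (u, 0) ≠ 0)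
    (hr : dv ρ (u, 0) * mixedArea g ν (u, 0) = dv (signedArea g ν) (u, 0))
    (hs : 0 < mixedArea g ν (u, 0) * signedArea (fun x => g x + ρ x • ν x) n (u, 0)) :
    gaussCurv (fun x => g x + ρ x • ν x) n (u, 0) =
        -(1 / 4) * (4 * cuspTorsion g u ^ 2 + singularCurv g ν u * cuspidalCurv g u ^ 2) ∧
      meanCurv (fun x => g x + ρ x • ν x) n (u, 0) =
        1 / 8 * (cuspidalCurv g u ^ 2 - 4 * singularCurv g ν u) := by
  have hW := hg.isOpen
  have sg := hg.contDiffAt hu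
  have sν := hg.contDiffAt_normal hu
  have sρ : ContDiffAt ℝ ∞ ρ (u, 0) := hρ.contDiffAt (hW.mem_nhds hu)
  have hax := eventually_axis hW hu
  have hgv := hnull u hu
  have hρu : du ρ (u, 0) = 0 :=
    du_eq_zero_of_axis sρ.differentiableAt_top (hax.mono fun t ht => hρ0 t ht)
  -- g_v vanishes along the whole axis, so M loses its g_uv term.
  have hguv : du (dv g) (u, 0) = 0 :=
    du_eq_zero_of_axis (contDiffAt_dv sg).differentiableAt_top (hax.mono fun t ht => hnull t ht)
  have hgvu : dv (du g) (u, 0) = 0 := by rw [dv_du sg, hguv]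
  have hCu := du_add_smul_on_axis hg hu hρ hρ0
  have hCv := dv_add_smul_on_axis hg hu hgv hρ (hρ0 u hu)
  rw [dv_signedArea hg hu hgv] at hδ hr
  rw [mixedArea_of_dv hgv] at hA hr hs
  rw [signedArea, hCu, hCv, det3_smul_mid] at hs
  have hr0 : dv ρ (u, 0) ≠ 0 := by
    intro h0; rw [h0, zero_mul] at hr; exact hδ hr.symm
  have haν := hg.inner_du hu
  have han : inner ℝ (du g (u, 0)) (n (u, 0)) = 0 := by
    have := hn.inner_du hu
    rwa [hCu] at this
  have hνn : inner ℝ (ν (u, 0)) (n (u, 0)) = 0 := by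
    have := hn.inner_dv hu
    rw [hCv, real_inner_smul_left] at this
    exact (mul_eq_zero.1 this).resolve_left hr0
  have key := inner_fderiv_fderiv_add_smul hW hg.smooth hg.normal.smooth hρ hu (hρ0 u hu) hνn
  have hL : coeffL (fun x => g x + ρ x • ν x) n (u, 0) =
      inner ℝ (du (du g) (u, 0)) (n (u, 0)) := by
    refine (key (1, 0) (1, 0)).trans ?_
    rw [show fderiv ℝ ρ (u, 0) (1, 0) = 0 from hρu, zero_mul, add_zero, add_zero]; rfl
  have hM : coeffM (fun x => g x + ρ x • ν x) n (u, 0) =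
      dv ρ (u, 0) * inner ℝ (du ν (u, 0)) (n (u, 0)) := by
    refine (key (1, 0) (0, 1)).trans ?_
    rw [show fderiv ℝ ρ (u, 0) (1, 0) = 0 from hρu,
      show fderiv ℝ (fun y => fderiv ℝ g y (1, 0)) (u, 0) (0, 1) = 0 from hgvu,
      inner_zero_left, zero_mul, add_zero, zero_add]; rfl
  have hN : coeffN (fun x => g x + ρ x • ν x) n (u, 0) =
      inner ℝ (dv (dv g) (u, 0)) (n (u, 0)) +
        2 * dv ρ (u, 0) * inner ℝ (dv ν (u, 0)) (n (u, 0)) := by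
    refine (key (0, 1) (0, 1)).trans ?_
    change inner ℝ (dv (dv g) (u, 0)) (n (u, 0)) +
      dv ρ (u, 0) * inner ℝ (dv ν (u, 0)) (n (u, 0)) +
      dv ρ (u, 0) * inner ℝ (dv ν (u, 0)) (n (u, 0)) = _
    ring
  have hE : coeffE (fun x => g x + ρ x • ν x) (u, 0) = inner ℝ (du g (u, 0)) (du g (u, 0)) := by
    rw [coeffE, hCu]
  have hF : coeffF (fun x => g x + ρ x • ν x) (u, 0) = 0 := by
    rw [coeffF, hCu, hCv, real_inner_smul_right, haν, mul_zero]
  have hν1 := hg.normal.norm_eq_one _ hu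
  have hG : coeffG (fun x => g x + ρ x • ν x) (u, 0) = dv ρ (u, 0) ^ 2 := by
    rw [coeffG, hCv, real_inner_smul_left, real_inner_smul_right, real_inner_self_eq_norm_sq, hν1]
    ring
  have hhν : inner ℝ (dv (dv g) (u, 0)) (ν (u, 0)) = 0 := by
    refine (hg.inner_fderiv_fderiv hu (0, 1) (0, 1)).trans ?_
    rw [show fderiv ℝ g (u, 0) (0, 1) = 0 from hgv, inner_zero_left, neg_zero]
  have hbν : inner ℝ (du (du g) (u, 0)) (ν (u, 0)) =
      -inner ℝ (du g (u, 0)) (du ν (u, 0)) := hg.inner_fderiv_fderiv hu (1, 0) (1, 0)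
  have haνv : inner ℝ (du g (u, 0)) (dv ν (u, 0)) = 0 := by
    rw [hg.inner_du_dv_comm hu, hgv, inner_zero_left]
  -- The factor 2 arises because ⟨g_vv, ν_v⟩ comes from both sides of the differentiated identity.
  have hcν : inner ℝ (dv (dv (dv g)) (u, 0)) (ν (u, 0)) =
      -2 * inner ℝ (dv (dv g) (u, 0)) (dv ν (u, 0)) := by
    have : inner ℝ (dv (dv (dv g)) (u, 0)) (ν (u, 0)) +
        inner ℝ (dv (dv g) (u, 0)) (dv ν (u, 0)) =
        -(inner ℝ (dv (dv g) (u, 0)) (dv ν (u, 0)) +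
          inner ℝ (dv g (u, 0)) (dv (dv ν) (u, 0))) :=
      inner_fderiv_of_inner_eq_neg (contDiffAt_dv (contDiffAt_dv sg)) sν (contDiffAt_dv sg)
        (contDiffAt_dv sν) ((hg.eventually_mem hu).mono fun x hx =>
          hg.inner_fderiv_fderiv hx (0, 1) (0, 1)) (0, 1)
    rw [hgv, inner_zero_left] at this
    linarith
  have heν : inner ℝ (dv (dv (du g)) (u, 0)) (ν (u, 0)) =
      -inner ℝ (dv (dv g) (u, 0)) (du ν (u, 0)) := by
    have : inner ℝ (dv (dv (du g)) (u, 0)) (ν (u, 0)) +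
        inner ℝ (dv (du g) (u, 0)) (dv ν (u, 0)) =
        -(inner ℝ (dv (dv g) (u, 0)) (du ν (u, 0)) +
          inner ℝ (dv g (u, 0)) (dv (du ν) (u, 0))) :=
      inner_fderiv_of_inner_eq_neg (contDiffAt_dv (contDiffAt_du sg)) sν (contDiffAt_dv sg)
        (contDiffAt_du sν) ((hg.eventually_mem hu).mono fun x hx => by
          rw [dv_du (hg.contDiffAt hx)]
          exact hg.inner_fderiv_fderiv hx (0, 1) (1, 0)) (0, 1)
    rw [hgv, hgvu, inner_zero_left, inner_zero_left] at this
    linarith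
  have hsign : 0 < det3 (du g (u, 0)) (dv (dv g) (u, 0)) (ν (u, 0)) *
      det3 (du g (u, 0)) (ν (u, 0)) (n (u, 0)) := by
    rw [← hr]; linarith
  have final := focal_curvature_algebra hν1 (hn.normal.norm_eq_one _ hu) haν hhν hcν heν hbν haνv
    han hνn (neg_ne_zero.1 hA) hδ hr hsign
  rw [gaussCurv, meanCurv, hL, hM, hN, hE, hF, hG, singularCurv, dv_signedArea hg hu hgv,
    cuspidalCurv, cuspTorsion]
  refine ⟨Eq.trans ?_ final.1, Eq.trans ?_ final.2⟩
  · congr 1; ring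
  · congr 1 <;> ring

end AdaptedCoordinates

/-! ### Adapted charts and nondegeneracy from the normal form. -/

/-- The standard cuspidal edge `(u, v) ↦ (u, v², v³)`. -/
noncomputable def stdCusp (x : ℝ × ℝ) : E3 := !₂[x.1, x.2 ^ 2, x.2 ^ 3]

theorem contDiff_stdCusp : ContDiff ℝ ∞ stdCusp := by
  rw [contDiff_euclidean]
  intro i
  fin_cases i <;> simp [stdCusp] <;> fun_prop

theorem fderiv_stdCusp (x X : ℝ × ℝ) :
    fderiv ℝ stdCusp x X = !₂[X.1, 2 * x.2 * X.2, 3 * x.2 ^ 2 * X.2] := by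
  have hd : DifferentiableAt ℝ stdCusp x := contDiff_stdCusp.contDiffAt.differentiableAt_top
  have key : ∀ i, (fderiv ℝ stdCusp x X) i = fderiv ℝ (fun y => stdCusp y i) x X := by
    intro i
    have h := (EuclideanSpace.proj i : E3 →L[ℝ] ℝ).hasFDerivAt.comp x
      hd.hasFDerivAt
    exact (congrArg (fun D : ℝ × ℝ →L[ℝ] ℝ => D X) h.fderiv).symm
  have h1 : HasFDerivAt (fun y : ℝ × ℝ => y.1) (ContinuousLinearMap.fst ℝ ℝ ℝ) x := hasFDerivAt_fst
  have h2 : HasFDerivAt (fun y : ℝ × ℝ => y.2) (ContinuousLinearMap.snd ℝ ℝ ℝ) x := hasFDerivAt_snd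
  refine E3.ext_coord ?_ ?_ ?_ <;> rw [key]
  · have : (fun y : ℝ × ℝ => stdCusp y 0) = fun y => y.1 := by funext y; simp [stdCusp]
    rw [this, h1.fderiv]; simp
  · have : (fun y : ℝ × ℝ => stdCusp y 1) = fun y => y.2 ^ 2 := by funext y; simp [stdCusp]
    rw [this, (h2.pow 2).fderiv]; simp
  · have : (fun y : ℝ × ℝ => stdCusp y 2) = fun y => y.2 ^ 3 := by funext y; simp [stdCusp]
    rw [this, (h2.pow 3).fderiv]; simp

theorem fderiv_injective_of_diffeo {Ψ : OpenPartialHomeomorph E3 E3}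
    (hΨ : ContDiffOn ℝ ∞ Ψ Ψ.source) (hΨ' : ContDiffOn ℝ ∞ Ψ.symm Ψ.target) {y : E3}
    (hy : y ∈ Ψ.source) : Function.Injective (fderiv ℝ Ψ y) := by
  have h1 : DifferentiableAt ℝ Ψ y :=
    (hΨ.contDiffAt (Ψ.open_source.mem_nhds hy)).differentiableAt (by simp)
  have h2 : DifferentiableAt ℝ Ψ.symm (Ψ y) :=
    (hΨ'.contDiffAt (Ψ.open_target.mem_nhds (Ψ.map_source hy))).differentiableAt (by simp)
  have h3 : (Ψ.symm ∘ Ψ) =ᶠ[𝓝 y] id :=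
    Filter.eventuallyEq_of_mem (Ψ.open_source.mem_nhds hy) fun z hz => Ψ.left_inv hz
  have h4 := h3.fderiv_eq (𝕜 := ℝ)
  rw [fderiv_comp y h2 h1, fderiv_id] at h4
  intro X Y hXY
  have h5 : ∀ Z : E3, fderiv ℝ Ψ.symm (Ψ y) (fderiv ℝ Ψ y Z) = Z := fun Z =>
    congrArg (fun D : E3 →L[ℝ] E3 => D Z) h4
  rw [← h5 X, ← h5 Y, hXY]

/-- A cuspidal edge in adapted coordinates: local model. -/
theorem exists_adapted_model {S : Set (ℝ × ℝ)} (hS : IsOpen S) {f : ℝ × ℝ → E3}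
    (hf : ContDiffOn ℝ ∞ f S) {p : ℝ × ℝ} (hp : p ∈ S) (hcusp : IsCuspidalEdgeAt f p) :
    ∃ (φ : OpenPartialHomeomorph (ℝ × ℝ) (ℝ × ℝ)) (Ψ : OpenPartialHomeomorph E3 E3),
      ContDiffOn ℝ ∞ φ φ.source ∧ ContDiffOn ℝ ∞ φ.symm φ.target ∧
      ContDiffOn ℝ ∞ Ψ Ψ.source ∧ ContDiffOn ℝ ∞ Ψ.symm Ψ.target ∧
      (0, 0) ∈ φ.source ∧ φ (0, 0) = p ∧ φ.target ⊆ S ∧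
      ∀ x ∈ φ.source, stdCusp x ∈ Ψ.source ∧ f (φ x) = Ψ (stdCusp x) := by
  obtain ⟨θ, Θ, h1, h2, h3, h4, hpθ, hθp, hfp, -, hev⟩ := hcusp
  have hcont : ContinuousAt f p := (hf.contDiffAt (hS.mem_nhds hp)).continuousAt
  have hev2 : ∀ᶠ q in 𝓝 p, Θ (f q) = stdCusp (θ q) ∧ f q ∈ Θ.source ∧ q ∈ S :=
    hev.and ((hcont.eventually (Θ.open_source.mem_nhds hfp)).and (hS.mem_nhds hp))
  obtain ⟨U, hU, hUo, hpU⟩ := eventually_nhds_iff.1 hev2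
  -- On U the germ equivalence holds pointwise, so f ∘ φ = Ψ ∘ `stdCusp` on the whole chart.
  refine ⟨(θ.restrOpen U hUo).symm, Θ.symm, ?_, ?_, h4, ?_, ?_, ?_, ?_, ?_⟩
  · exact h2.mono fun x (hx : x ∈ θ.target ∩ θ.symm ⁻¹' U) => hx.1
  · exact h1.mono fun x (hx : x ∈ θ.source ∩ U) => hx.1
  · simpa using h3
  · refine ⟨?_, ?_⟩
    · have := θ.map_source hpθ
      rwa [hθp] at this
    · change θ.symm (0, 0) ∈ U
      have := θ.left_inv hpθ
      rw [hθp] at this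
      have h0 : θ.symm (0, 0) = p := this
      rw [h0]
      exact hpU
  · have := θ.left_inv hpθ
    rw [hθp] at this
    exact this
  · intro q hq
    exact (hU q hq.2).2.2
  · intro x hx
    have hx1 : x ∈ θ.target := hx.1
    have hx2 : θ.symm x ∈ U := hx.2
    obtain ⟨e1, e2, -⟩ := hU _ hx2
    rw [θ.right_inv hx1] at e1
    refine ⟨?_, ?_⟩
    · rw [← e1]; exact Θ.map_source e2
    · change f (θ.symm x) = Θ.symm (stdCusp x)
      rw [← e1, Θ.left_inv e2]

/-- Adapted coordinates exist at a cuspidal edge, and `f_u`, `f_vv` are independent there. -/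
theorem exists_adapted {S : Set (ℝ × ℝ)} (hS : IsOpen S) {f : ℝ × ℝ → E3}
    (hf : ContDiffOn ℝ ∞ f S) {p : ℝ × ℝ} (hp : p ∈ S) (hcusp : IsCuspidalEdgeAt f p) :
    ∃ φ : OpenPartialHomeomorph (ℝ × ℝ) (ℝ × ℝ), IsAdaptedAt f S p φ ∧
      cross (du (f ∘ φ) (0, 0)) (dv (dv (f ∘ φ)) (0, 0)) ≠ 0 := by
  obtain ⟨φ, Ψ, h1, h2, h3, h4, h0, hφ0, hsub, hmod⟩ := exists_adapted_model hS hf hp hcusp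
  have hinj : ∀ x ∈ φ.source, Function.Injective (fderiv ℝ Ψ (stdCusp x)) := fun x hx =>
    fderiv_injective_of_diffeo h3 h4 (hmod x hx).1
  have hΨ : ∀ x ∈ φ.source, ContDiffAt ℝ ∞ Ψ (stdCusp x) := fun x hx =>
    h3.contDiffAt (Ψ.open_source.mem_nhds (hmod x hx).1)
  have hD : ∀ x ∈ φ.source, ∀ X, fderiv ℝ (f ∘ φ) x X =
      fderiv ℝ Ψ (stdCusp x) !₂[X.1, 2 * x.2 * X.2, 3 * x.2 ^ 2 * X.2] := by
    intro x hx X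
    have : (f ∘ φ) =ᶠ[𝓝 x] (Ψ ∘ stdCusp) :=
      Filter.eventuallyEq_of_mem (φ.open_source.mem_nhds hx) fun y hy => (hmod y hy).2
    rw [this.fderiv_eq, fderiv_comp x ((hΨ x hx).differentiableAt (by simp))
      contDiff_stdCusp.contDiffAt.differentiableAt_top, ContinuousLinearMap.comp_apply,
      fderiv_stdCusp]
  have hnull : ∀ u : ℝ, (u, 0) ∈ φ.source → dv (f ∘ φ) (u, 0) = 0 := by
    intro u hu
    rw [dv, hD _ hu, ← map_zero (fderiv ℝ Ψ (stdCusp (u, 0)))]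
    congr 1
    refine E3.ext_coord ?_ ?_ ?_ <;> simp
  refine ⟨φ, ⟨h1, h2, h0, hφ0, hsub, ?_, hnull⟩, ?_⟩
  · intro x hx
    constructor
    · intro hx'
      by_contra hx2
      refine hx' ((injective_iff_map_eq_zero _).2 fun X hX => ?_)
      rw [hD x hx, ← map_zero (fderiv ℝ Ψ (stdCusp x))] at hX
      have hX' := hinj x hx hX
      have c0 := congrArg (fun w : E3 => w 0) hX'
      have c1 := congrArg (fun w : E3 => w 1) hX'
      simp [hx2] at c0 c1
      exact Prod.ext c0 c1
    · intro hx2 hreg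
      obtain ⟨u, v⟩ := x
      obtain rfl : v = 0 := hx2
      have := hreg ((hnull u hx).trans (map_zero _).symm : fderiv ℝ (f ∘ φ) (u, 0) (0, 1) = _)
      simp at this
  · have hu : du (f ∘ φ) (0, 0) = fderiv ℝ Ψ (stdCusp (0, 0)) !₂[1, 0, 0] := by
      rw [du, hD _ h0]; simp
    have hk : ContDiffAt ℝ ∞
        (fun x : ℝ × ℝ => fderiv ℝ Ψ (stdCusp x) !₂[0, 2, 3 * x.2]) (0, 0) := by
      refine ContDiffAt.clm_apply ?_ ?_
      · exact ((hΨ _ h0).fderiv_right (m := ∞) (by simp)).comp (0, 0) contDiff_stdCusp.contDiffAt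
      · rw [contDiffAt_euclidean]
        intro i
        fin_cases i <;> simp <;> fun_prop
    -- With the factor v extracted, the v-derivative at v = 0 involves no derivative of dΨ.
    have hv : dv (f ∘ φ) =ᶠ[𝓝 (0, 0)]
        fun x : ℝ × ℝ => x.2 • fderiv ℝ Ψ (stdCusp x) !₂[0, 2, 3 * x.2] := by
      refine Filter.eventuallyEq_of_mem (φ.open_source.mem_nhds h0) fun x hx => ?_
      rw [dv, hD _ hx, ← map_smul]
      congr 1
      refine E3.ext_coord ?_ ?_ ?_ <;> simp <;> ring
    have hvv : dv (dv (f ∘ φ)) (0, 0) = fderiv ℝ Ψ (stdCusp (0, 0)) !₂[0, 2, 0] := by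
      rw [dv, hv.fderiv_eq, fderiv_smul_apply_eq differentiableAt_snd hk.differentiableAt_top,
        fderiv_snd]
      simp
    rw [hu, hvv, cross_ne_zero_iff]
    intro a b hab
    rw [← map_smul, ← map_smul, ← map_add, ← map_zero (fderiv ℝ Ψ (stdCusp (0, 0)))] at hab
    have hX := hinj _ h0 hab
    have c0 := congrArg (fun w : E3 => w 0) hX
    have c1 := congrArg (fun w : E3 => w 1) hX
    simp at c0 c1
    exact ⟨c0, c1⟩

theorem eq_zero_of_change {E : Type*} [AddCommGroup E] [Module ℝ E] {a b c d : ℝ} {x y : E}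
    (hJ : a * d - b * c ≠ 0) (h1 : a • x + b • y = 0) (h2 : c • x + d • y = 0) :
    x = 0 ∧ y = 0 := by
  have e1 : (a * d - b * c) • x = d • (a • x + b • y) - b • (c • x + d • y) := by module
  have e2 : (a * d - b * c) • y = a • (c • x + d • y) - c • (a • x + b • y) := by module
  rw [h1, h2, smul_zero, smul_zero, sub_zero, smul_eq_zero] at e1 e2
  exact ⟨e1.resolve_left hJ, e2.resolve_left hJ⟩

theorem fderiv_eq_zero_iff {E : Type*} [NormedAddCommGroup E] [NormedSpace ℝ E]
    (F : ℝ × ℝ → E) (q : ℝ × ℝ) : fderiv ℝ F q = 0 ↔ du F q = 0 ∧ dv F q = 0 := by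
  refine ⟨fun h => by simp [du, dv, h], fun h => ?_⟩
  refine ContinuousLinearMap.ext fun X => ?_
  rw [fderiv_apply_eq, h.1, h.2]; simp

/-- Pulling the pair `(f, ν)` back to adapted coordinates. -/
theorem IsAdaptedAt.isNormalPair {f ν : ℝ × ℝ → E3} {S V : Set (ℝ × ℝ)} {p : ℝ × ℝ}
    {φ : OpenPartialHomeomorph (ℝ × ℝ) (ℝ × ℝ)} (hφ : IsAdaptedAt f S p φ)
    (hf : IsNormalPair f ν V) :
    IsNormalPair (f ∘ φ) (ν ∘ φ) (φ.source ∩ φ ⁻¹' V) :=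
  hf.comp (φ.isOpen_inter_preimage hf.isOpen) (hφ.smooth.mono Set.inter_subset_left)
    fun _ hx => hx.2

section Axis

variable {f ν : ℝ × ℝ → E3} {S V : Set (ℝ × ℝ)} {p : ℝ × ℝ} {u : ℝ}
  {φ : OpenPartialHomeomorph (ℝ × ℝ) (ℝ × ℝ)}

theorem IsAdaptedAt.signedArea_eq_zero (hφ : IsAdaptedAt f S p φ) (hf : IsNormalPair f ν V)
    (hu : (u, 0) ∈ φ.source ∩ φ ⁻¹' V) : signedArea f ν (φ (u, 0)) = 0 := by
  have h1 := signedArea_comp (n := ν) (hf.contDiffAt hu.2).differentiableAt_top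
    (hφ.smooth.contDiffAt (φ.open_source.mem_nhds hu.1)).differentiableAt_top
  rw [signedArea_eq_zero_of_dv (hφ.null u hu.1)] at h1
  exact (mul_eq_zero.1 h1.symm).resolve_left (jac_ne_zero hφ.smooth hφ.smooth_symm hu.1)

/-- `dλ` at a singular point in terms of `λ_v` in adapted coordinates. -/
theorem IsAdaptedAt.dv_signedArea_eq (hφ : IsAdaptedAt f S p φ) (hf : IsNormalPair f ν V)
    (hu : (u, 0) ∈ φ.source ∩ φ ⁻¹' V) :
    dv (signedArea (f ∘ φ) (ν ∘ φ)) (u, 0) =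
      jac φ (u, 0) * dv (signedArea f ν ∘ φ) (u, 0) := by
  have sφ : ∀ x ∈ φ.source, ContDiffAt ℝ ∞ φ x := fun x hx =>
    hφ.smooth.contDiffAt (φ.open_source.mem_nhds hx)
  have sl := (contDiffAt_signedArea (hf.contDiffAt hu.2) (hf.contDiffAt_normal hu.2)).comp _
    (sφ _ hu.1)
  have h1 : signedArea (f ∘ φ) (ν ∘ φ) =ᶠ[𝓝 (u, 0)]
      fun x => jac φ x * (signedArea f ν ∘ φ) x :=
    Filter.eventuallyEq_of_mem ((hφ.isNormalPair hf).isOpen.mem_nhds hu) fun x hx =>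
      signedArea_comp (hf.contDiffAt hx.2).differentiableAt_top
        (sφ x hx.1).differentiableAt_top
  rw [dv, h1.fderiv_eq, fderiv_mul_apply_eq (contDiffAt_jac (sφ _ hu.1)).differentiableAt_top
    sl.differentiableAt_top, Function.comp_apply, hφ.signedArea_eq_zero hf hu, mul_zero, add_zero]
  rfl

theorem IsAdaptedAt.dv_signedArea_ne_zero_iff (hφ : IsAdaptedAt f S p φ)
    (hf : IsNormalPair f ν V) (hu : (u, 0) ∈ φ.source ∩ φ ⁻¹' V) :
    dv (signedArea (f ∘ φ) (ν ∘ φ)) (u, 0) ≠ 0 ↔ fderiv ℝ (signedArea f ν) (φ (u, 0)) ≠ 0 := by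
  have hJ := jac_ne_zero hφ.smooth hφ.smooth_symm hu.1
  have sφ := hφ.smooth.contDiffAt (φ.open_source.mem_nhds hu.1)
  have sl := contDiffAt_signedArea (hf.contDiffAt hu.2) (hf.contDiffAt_normal hu.2)
  rw [hφ.dv_signedArea_eq hf hu, mul_ne_zero_iff, and_iff_right hJ]
  refine not_congr ?_
  rw [fderiv_eq_zero_iff]
  have e2 := dv_comp sl.differentiableAt_top sφ.differentiableAt_top
  constructor
  · intro h0
    have e1 := du_comp sl.differentiableAt_top sφ.differentiableAt_top
    -- λ ∘ φ vanishes along the axis, so its v-derivative carries all of dλ.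
    have hax : du (signedArea f ν ∘ φ) (u, 0) = 0 :=
      du_eq_zero_of_axis (sl.comp _ sφ).differentiableAt_top
        ((eventually_axis (hφ.isNormalPair hf).isOpen hu).mono fun t ht =>
          hφ.signedArea_eq_zero hf ht)
    rw [hax] at e1
    rw [h0] at e2
    exact eq_zero_of_change hJ e1.symm e2.symm
  · rintro ⟨h1, h2⟩
    rw [e2, h1, h2, smul_zero, smul_zero, add_zero]

end Axis

/-- At a cuspidal edge of a front, `dλ` and `2 λ H` do not vanish. -/
theorem nondegenerate_of_isCuspidalEdgeAt {S : Set (ℝ × ℝ)} (hS : IsOpen S)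
    {f ν : ℝ × ℝ → E3} (hf : IsFrontOn f ν S) {p : ℝ × ℝ} (hp : p ∈ S)
    (hcusp : IsCuspidalEdgeAt f p) :
    ∃ φ, IsAdaptedAt f S p φ ∧ fderiv ℝ (signedArea f ν) p ≠ 0 ∧ mixedArea f ν p ≠ 0 := by
  obtain ⟨φ, hφ, hcr⟩ := exists_adapted hS hf.smooth hp hcusp
  have hP : IsNormalPair f ν S := ⟨hS, hf.smooth, hf.normal⟩
  have hu : ((0 : ℝ), (0 : ℝ)) ∈ φ.source ∩ φ ⁻¹' S :=
    ⟨hφ.zero_mem, hφ.target_subset (φ.map_source hφ.zero_mem)⟩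
  have hg := hφ.isNormalPair hP
  have hgv := hφ.null 0 hφ.zero_mem
  have hν1 := hg.normal.norm_eq_one _ hu
  have hJ := jac_ne_zero hφ.smooth hφ.smooth_symm hu.1
  have sφ := (hφ.smooth.contDiffAt (φ.open_source.mem_nhds hu.1)).differentiableAt_top
  have sf := (hP.contDiffAt hu.2).differentiableAt_top
  have sν := (hP.contDiffAt_normal hu.2).differentiableAt_top
  refine ⟨φ, hφ, ?_, ?_⟩
  · rw [← hφ.map_zero, ← hφ.dv_signedArea_ne_zero_iff hP hu, dv_signedArea hg hu hgv]
    refine det3_ne_zero_of_unit hν1 (hg.inner_du hu) ?_ hcr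
    refine (hg.inner_fderiv_fderiv hu (0, 1) (0, 1)).trans ?_
    rw [show fderiv ℝ (f ∘ φ) (0, 0) (0, 1) = 0 from hgv, inner_zero_left, neg_zero]
  · have ha : du (f ∘ φ) (0, 0) ≠ 0 := by
      intro h0
      exact one_ne_zero ((cross_ne_zero_iff _ _).1 hcr 1 0 (by rw [h0]; simp)).1
    -- Otherwise d(f, ν) would kill dφ(∂_v), a nonzero vector; this is where the front condition is
    -- used.
    have hw : dv (ν ∘ φ) (0, 0) ≠ 0 := by
      intro h0
      have e1 : fderiv ℝ f (φ (0, 0)) (dv φ (0, 0)) = 0 := (fderiv_comp_eq sf sφ _).symm.trans hgv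
      have e2 : fderiv ℝ ν (φ (0, 0)) (dv φ (0, 0)) = 0 := (fderiv_comp_eq sν sφ _).symm.trans h0
      have e3 : fderiv ℝ (fun x => (f x, ν x)) (φ (0, 0)) (dv φ (0, 0)) = 0 := by
        rw [sf.fderiv_prodMk sν, ContinuousLinearMap.prod_apply, e1, e2]; rfl
      have e4 := hf.immersion _ hu.2 (e3.trans (map_zero _).symm)
      apply hJ
      rw [jac, e4]; simp
    have h1 := mixedArea_comp sf sν sφ
    rw [mixedArea_of_dv hgv] at h1
    have haw : inner ℝ (du (f ∘ φ) (0, 0)) (dv (ν ∘ φ) (0, 0)) = 0 := by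
      rw [hg.inner_du_dv_comm hu, hgv, inner_zero_left]
    -- Since f_u ⊥ ν_v, the square of det(f_u, ν_v, ν) is |f_u|²|ν_v|².
    have h2 := det3_mul_det3_unit (x' := du (f ∘ φ) (0, 0)) (y' := dv (ν ∘ φ) (0, 0)) hν1
      (hg.inner_du hu) (hg.inner_normal_fderiv hu (0, 1))
    rw [show fderiv ℝ (ν ∘ φ) (0, 0) (0, 1) = dv (ν ∘ φ) (0, 0) from rfl, haw, zero_mul, sub_zero,
      real_inner_self_eq_norm_sq, real_inner_self_eq_norm_sq] at h2
    intro h0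
    rw [← hφ.map_zero] at h0
    rw [h0, mul_zero, neg_eq_zero] at h1
    rw [h1, zero_mul] at h2
    have : 0 < ‖du (f ∘ φ) (0, 0)‖ ^ 2 * ‖dv (ν ∘ φ) (0, 0)‖ ^ 2 := by positivity
    exact this.ne h2

/-! ### The focal surface in adapted coordinates. -/

section FocalCoordinates

variable {f ν : ℝ × ℝ → E3} {S V : Set (ℝ × ℝ)} {p : ℝ × ℝ} {u : ℝ} {k : ℝ × ℝ → ℝ}
  {φ : OpenPartialHomeomorph (ℝ × ℝ) (ℝ × ℝ)}

/-- The radius function `λ / k` on the singular curve, in adapted coordinates, where `k` is a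
nonvanishing root of `k² - 2 λ H k + λ² K = 0`. -/
theorem IsAdaptedAt.radius_on_axis (hφ : IsAdaptedAt f S p φ) (hf : IsNormalPair f ν V)
    (hk : ContDiffOn ℝ ∞ k V) (hk0 : ∀ q ∈ V, k q ≠ 0)
    (hroot : ∀ q ∈ V, k q ^ 2 - mixedArea f ν q * k q + signedArea f ν q * normalArea ν q = 0)
    (hu : (u, 0) ∈ φ.source ∩ φ ⁻¹' V) :
    ContDiffOn ℝ ∞ ((fun q => signedArea f ν q / k q) ∘ φ) (φ.source ∩ φ ⁻¹' V) ∧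
    (∀ t : ℝ, (t, 0) ∈ φ.source ∩ φ ⁻¹' V → ((fun q => signedArea f ν q / k q) ∘ φ) (t, 0) = 0) ∧
    mixedArea f ν (φ (u, 0)) = k (φ (u, 0)) ∧
    mixedArea (f ∘ φ) (ν ∘ φ) (u, 0) ≠ 0 ∧
    dv ((fun q => signedArea f ν q / k q) ∘ φ) (u, 0) * mixedArea (f ∘ φ) (ν ∘ φ) (u, 0) =
      dv (signedArea (f ∘ φ) (ν ∘ φ)) (u, 0) := by
  have hW := (hφ.isNormalPair hf).isOpen
  have sl : ContDiffOn ℝ ∞ (signedArea f ν) V := fun q hq =>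
    (contDiffAt_signedArea (hf.contDiffAt hq) (hf.contDiffAt_normal hq)).contDiffWithinAt
  have sφ : ContDiffOn ℝ ∞ φ (φ.source ∩ φ ⁻¹' V) := hφ.smooth.mono Set.inter_subset_left
  have sρ : ContDiffOn ℝ ∞ ((fun q => signedArea f ν q / k q) ∘ φ) (φ.source ∩ φ ⁻¹' V) :=
    (sl.div hk hk0).comp sφ fun x hx => hx.2
  have sφu := (sφ.contDiffAt (hW.mem_nhds hu)).differentiableAt_top
  have sku : DifferentiableAt ℝ (k ∘ φ) (u, 0) :=
    ((hk.comp sφ fun x hx => hx.2).contDiffAt (hW.mem_nhds hu)).differentiableAt_top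
  have hρ0 : ∀ t : ℝ, (t, 0) ∈ φ.source ∩ φ ⁻¹' V →
      ((fun q => signedArea f ν q / k q) ∘ φ) (t, 0) = 0 := fun t ht => by
    rw [Function.comp_apply, hφ.signedArea_eq_zero hf ht, zero_div]
  have hA : mixedArea f ν (φ (u, 0)) = k (φ (u, 0)) := by
    have h1 := hroot _ hu.2
    rw [hφ.signedArea_eq_zero hf hu, zero_mul, add_zero] at h1
    -- Where λ = 0 the quadratic reduces to k(k - A) = 0.
    have h2 : k (φ (u, 0)) * (k (φ (u, 0)) - mixedArea f ν (φ (u, 0))) = 0 := by linarith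
    have h3 := (mul_eq_zero.1 h2).resolve_left (hk0 _ hu.2)
    linarith
  have hA' := mixedArea_comp (hf.contDiffAt hu.2).differentiableAt_top
    (hf.contDiffAt_normal hu.2).differentiableAt_top sφu
  rw [hA] at hA'
  refine ⟨sρ, hρ0, hA, ?_, ?_⟩
  · rw [hA']
    exact mul_ne_zero (jac_ne_zero hφ.smooth hφ.smooth_symm hu.1) (hk0 _ hu.2)
  -- Differentiating λ = ρk at a zero of ρ gives λ_v = ρ_v k.
  · have h1 : (signedArea f ν ∘ φ) =ᶠ[𝓝 (u, 0)]
        fun x => ((fun q => signedArea f ν q / k q) ∘ φ) x * (k ∘ φ) x :=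
      Filter.eventuallyEq_of_mem (hW.mem_nhds hu) fun x hx =>
        (div_mul_cancel₀ _ (hk0 _ hx.2)).symm
    have h2 : dv (signedArea f ν ∘ φ) (u, 0) =
        dv ((fun q => signedArea f ν q / k q) ∘ φ) (u, 0) * k (φ (u, 0)) := by
      rw [dv, h1.fderiv_eq, fderiv_mul_apply_eq
        (sρ.contDiffAt (hW.mem_nhds hu)).differentiableAt_top sku, hρ0 u hu, zero_mul, zero_add]
      rfl
    rw [hφ.dv_signedArea_eq hf hu, h2, hA']
    ring

/-- The focal surface is regular at the singular points of `f`. -/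
theorem IsAdaptedAt.cross_focal_ne_zero (hφ : IsAdaptedAt f S p φ) (hf : IsNormalPair f ν V)
    (hk : ContDiffOn ℝ ∞ k V) (hk0 : ∀ q ∈ V, k q ≠ 0)
    (hroot : ∀ q ∈ V, k q ^ 2 - mixedArea f ν q * k q + signedArea f ν q * normalArea ν q = 0)
    (hu : (u, 0) ∈ φ.source ∩ φ ⁻¹' V) (hl : fderiv ℝ (signedArea f ν) (φ (u, 0)) ≠ 0)
    {C : ℝ × ℝ → E3} (hC : DifferentiableAt ℝ C (φ (u, 0)))
    (hCdef : ∀ q, C q = f q + (signedArea f ν q / k q) • ν q) :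
    cross (du C (φ (u, 0))) (dv C (φ (u, 0))) ≠ 0 := by
  obtain ⟨sρ, hρ0, -, hA, hr⟩ := hφ.radius_on_axis hf hk hk0 hroot hu
  have hg := hφ.isNormalPair hf
  have sφ := (hφ.smooth.contDiffAt (φ.open_source.mem_nhds hu.1)).differentiableAt_top
  have hgv := hφ.null u hu.1
  have hfun : C ∘ φ = fun x =>
      (f ∘ φ) x + ((fun q => signedArea f ν q / k q) ∘ φ) x • (ν ∘ φ) x := by
    funext x; exact hCdef _
  have hr0 : dv ((fun q => signedArea f ν q / k q) ∘ φ) (u, 0) ≠ 0 := by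
    intro h0
    rw [h0, zero_mul] at hr
    exact (hφ.dv_signedArea_ne_zero_iff hf hu).2 hl hr.symm
  have e1 : du (C ∘ φ) (u, 0) = du (f ∘ φ) (u, 0) := by
    rw [hfun]; exact du_add_smul_on_axis hg hu sρ hρ0
  have e2 : dv (C ∘ φ) (u, 0) = dv ((fun q => signedArea f ν q / k q) ∘ φ) (u, 0) •
      (ν ∘ φ) (u, 0) := by
    rw [hfun]; exact dv_add_smul_on_axis hg hu hgv sρ (hρ0 u hu)
  -- With ν_v as test vector, the determinant is ρ_v A.
  have h1 : det3 (du (C ∘ φ) (u, 0)) (dv (C ∘ φ) (u, 0)) (dv (ν ∘ φ) (u, 0)) ≠ 0 := by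
    rw [e1, e2, det3_smul_mid, det3_swap_right]
    rw [mixedArea_of_dv hgv] at hA
    exact mul_ne_zero hr0 hA
  rw [du_comp hC sφ, dv_comp hC sφ, det3_change] at h1
  exact cross_ne_zero_of_det3 (right_ne_zero_of_mul h1)

/-- The curvatures of the focal surface at the singular points of `f`. -/
theorem IsAdaptedAt.focal_curvatures (hφ : IsAdaptedAt f S p φ) (hf : IsNormalPair f ν V)
    (hk : ContDiffOn ℝ ∞ k V) (hk0 : ∀ q ∈ V, k q ≠ 0)
    (hroot : ∀ q ∈ V, k q ^ 2 - mixedArea f ν q * k q + signedArea f ν q * normalArea ν q = 0)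
    (hu : (u, 0) ∈ φ.source ∩ φ ⁻¹' V) (hl : fderiv ℝ (signedArea f ν) (φ (u, 0)) ≠ 0)
    {C n : ℝ × ℝ → E3} (hC : IsNormalPair C n V)
    (hCdef : ∀ q, C q = f q + (signedArea f ν q / k q) • ν q)
    (hs : 0 < k (φ (u, 0)) * signedArea C n (φ (u, 0))) :
    gaussCurv C n (φ (u, 0)) = -(1 / 4) * (4 * cuspTorsion (f ∘ φ) u ^ 2 +
        singularCurv (f ∘ φ) (ν ∘ φ) u * cuspidalCurv (f ∘ φ) u ^ 2) ∧
    meanCurv C n (φ (u, 0)) =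
      1 / 8 * (cuspidalCurv (f ∘ φ) u ^ 2 - 4 * singularCurv (f ∘ φ) (ν ∘ φ) u) := by
  obtain ⟨sρ, hρ0, hAk, hA, hr⟩ := hφ.radius_on_axis hf hk hk0 hroot hu
  have hg := hφ.isNormalPair hf
  have hJ := jac_ne_zero hφ.smooth hφ.smooth_symm hu.1
  have sφ : ContDiffOn ℝ ∞ φ (φ.source ∩ φ ⁻¹' V) := hφ.smooth.mono Set.inter_subset_left
  have sφu := (sφ.contDiffAt (hg.isOpen.mem_nhds hu)).differentiableAt_top
  have hmaps : Set.MapsTo φ (φ.source ∩ φ ⁻¹' V) V := fun x hx => hx.2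
  have hfun : C ∘ φ = fun x =>
      (f ∘ φ) x + ((fun q => signedArea f ν q / k q) ∘ φ) x • (ν ∘ φ) x := by
    funext x; exact hCdef _
  have hC' := hC.comp hg.isOpen sφ hmaps
  have hs' : 0 < mixedArea (f ∘ φ) (ν ∘ φ) (u, 0) * signedArea (C ∘ φ) (n ∘ φ) (u, 0) := by
    rw [mixedArea_comp (hf.contDiffAt hu.2).differentiableAt_top
      (hf.contDiffAt_normal hu.2).differentiableAt_top sφu,
      signedArea_comp (hC.contDiffAt hu.2).differentiableAt_top sφu, hAk]
    -- The two Jacobian factors multiply to a square, so the orientation does not depend on the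
    -- chart.
    have : 0 < jac φ (u, 0) ^ 2 := by positivity
    have := mul_pos this hs
    linarith
  rw [← hC.gaussCurv_comp hg.isOpen sφ hmaps hu hJ, ← hC.meanCurv_comp hg.isOpen sφ hmaps hu hJ]
  rw [hfun] at hC' hs' ⊢
  exact curvatures_on_axis hg hu (fun t ht => hφ.null t ht.1) sρ hC' hρ0
    ((hφ.dv_signedArea_ne_zero_iff hf hu).2 hl) hA hr hs'

end FocalCoordinates

/-- A regular surface carries a smooth unit normal field, oriented by the sign of a given
nonvanishing smooth function. -/
theorem exists_oriented_normal {C : ℝ × ℝ → E3} {V : Set (ℝ × ℝ)} (hV : IsOpen V)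
    (hC : ContDiffOn ℝ ∞ C V) (hreg : ∀ q ∈ V, cross (du C q) (dv C q) ≠ 0) {k : ℝ × ℝ → ℝ}
    (hk : ContDiffOn ℝ ∞ k V) (hk0 : ∀ q ∈ V, k q ≠ 0) :
    ∃ n : ℝ × ℝ → E3, IsUnitNormalOn C n V ∧ ∀ q ∈ V, 0 < k q * signedArea C n q := by
  set w : ℝ × ℝ → E3 := fun q => k q • cross (du C q) (dv C q) with hw
  have hw0 : ∀ q ∈ V, w q ≠ 0 := fun q hq => smul_ne_zero (hk0 q hq) (hreg q hq)
  have sC : ∀ q ∈ V, ContDiffAt ℝ ∞ C q := fun q hq => hC.contDiffAt (hV.mem_nhds hq)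
  have sw : ContDiffOn ℝ ∞ w V :=
    hk.smul fun q hq => (ContDiffAt.cross (contDiffAt_du (sC q hq))
      (contDiffAt_dv (sC q hq))).contDiffWithinAt
  refine ⟨fun q => ‖w q‖⁻¹ • w q, ⟨?_, ?_, ?_⟩, ?_⟩
  · exact ((sw.norm ℝ hw0).inv fun q hq => norm_ne_zero_iff.2 (hw0 q hq)).smul sw
  · intro q hq
    rw [norm_smul, norm_inv, norm_norm, inv_mul_cancel₀ (norm_ne_zero_iff.2 (hw0 q hq))]
  · intro q hq X
    rw [fderiv_apply_eq, hw, inner_add_left]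
    simp only [real_inner_smul_left, real_inner_smul_right, inner_left_cross, inner_right_cross]
    simp
  · intro q hq
    have h1 : 0 < ‖w q‖⁻¹ := inv_pos.2 (norm_pos_iff.2 (hw0 q hq))
    have h2 : (inner ℝ (cross (du C q) (dv C q)) (cross (du C q) (dv C q)) : ℝ) > 0 :=
      real_inner_self_pos.2 (hreg q hq)
    have h3 : 0 < k q ^ 2 := by have := hk0 q hq; positivity
    have h4 : k q * signedArea C (fun q => ‖w q‖⁻¹ • w q) q = ‖w q‖⁻¹ * (k q ^ 2 *
        inner ℝ (cross (du C q) (dv C q)) (cross (du C q) (dv C q))) := by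
      rw [signedArea, det3_smul_right, det3_smul_right, inner_cross]; ring
    rw [h4]
    positivity

/-! ### Principal curvatures as roots of a quadratic with smooth coefficients. -/

/-- The root of `X² - A X + λ B = 0`, with `A = 2 λ H` and `λ B = λ² K`, that is nearest to `A`
if `σ` is the sign of `A`. -/
noncomputable def largeRoot (f ν : ℝ × ℝ → E3) (σ : ℝ) (q : ℝ × ℝ) : ℝ :=
  (mixedArea f ν q + σ * √(mixedArea f ν q ^ 2 - 4 * (signedArea f ν q * normalArea ν q))) / 2

theorem largeRoot_quadratic {f ν : ℝ × ℝ → E3} {σ : ℝ} (hσ : σ ^ 2 = 1) {q : ℝ × ℝ}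
    (hq : 0 ≤ mixedArea f ν q ^ 2 - 4 * (signedArea f ν q * normalArea ν q)) :
    largeRoot f ν σ q ^ 2 - mixedArea f ν q * largeRoot f ν σ q +
      signedArea f ν q * normalArea ν q = 0 := by
  rw [largeRoot]
  linear_combination (1 / 4 : ℝ) * σ ^ 2 * Real.sq_sqrt hq +
    (1 / 4) * (mixedArea f ν q ^ 2 - 4 * (signedArea f ν q * normalArea ν q)) * hσ

theorem contDiffAt_largeRoot {f ν : ℝ × ℝ → E3} {S : Set (ℝ × ℝ)} (hf : IsNormalPair f ν S)
    (σ : ℝ) {q : ℝ × ℝ} (hqS : q ∈ S)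
    (hq : 0 < mixedArea f ν q ^ 2 - 4 * (signedArea f ν q * normalArea ν q)) :
    ContDiffAt ℝ ∞ (largeRoot f ν σ) q := by
  have h1 := contDiffAt_mixedArea (hf.contDiffAt hqS) (hf.contDiffAt_normal hqS)
  have h2 := contDiffAt_signedArea (hf.contDiffAt hqS) (hf.contDiffAt_normal hqS)
  have h3 := contDiffAt_normalArea (hf.contDiffAt_normal hqS)
  have h4 := ((h1.pow 2).sub (contDiffAt_const (c := (4 : ℝ)) |>.mul (h2.mul h3))).sqrt hq.ne'
  exact (h1.add (contDiffAt_const.mul h4)).div_const 2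

/-- Near a nondegenerate singular point `p` there is a smooth nonvanishing function `k` with
`k² - 2 λ H k + λ² K = 0`. -/
theorem exists_root {f ν : ℝ × ℝ → E3} {S : Set (ℝ × ℝ)} (hf : IsNormalPair f ν S)
    {p : ℝ × ℝ} (hp : p ∈ S) (hl : signedArea f ν p = 0) (hA : mixedArea f ν p ≠ 0) :
    ∃ k : ℝ × ℝ → ℝ, ContinuousAt k p ∧ k p = mixedArea f ν p ∧
      ∀ᶠ q in 𝓝 p, ContDiffAt ℝ ∞ k q ∧ k q ≠ 0 ∧
        k q ^ 2 - mixedArea f ν q * k q + signedArea f ν q * normalArea ν q = 0 := by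
  -- The sign of A at p, held constant nearby so that the chosen root stays smooth.
  obtain ⟨σ, hσ, hσA⟩ : ∃ σ : ℝ, σ ^ 2 = 1 ∧ σ * |mixedArea f ν p| = mixedArea f ν p := by
    rcases lt_or_gt_of_ne hA with h | h
    · exact ⟨-1, by norm_num, by rw [abs_of_neg h]; ring⟩
    · exact ⟨1, by norm_num, by rw [abs_of_pos h]; ring⟩
  have hd : 0 < mixedArea f ν p ^ 2 - 4 * (signedArea f ν p * normalArea ν p) := by
    rw [hl]; simp only [zero_mul, mul_zero, sub_zero]; positivity
  have hkp : largeRoot f ν σ p = mixedArea f ν p := by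
    rw [largeRoot, hl, zero_mul, mul_zero, sub_zero, Real.sqrt_sq_eq_abs, hσA]; ring
  have hkc := (contDiffAt_largeRoot hf σ hp hd).continuousAt
  have hdc : ContinuousAt
      (fun q => mixedArea f ν q ^ 2 - 4 * (signedArea f ν q * normalArea ν q)) p :=
    (((contDiffAt_mixedArea (hf.contDiffAt hp) (hf.contDiffAt_normal hp)).pow 2).sub
      (contDiffAt_const.mul ((contDiffAt_signedArea (hf.contDiffAt hp)
      (hf.contDiffAt_normal hp)).mul (contDiffAt_normalArea (hf.contDiffAt_normal hp))))).continuousAt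
  refine ⟨largeRoot f ν σ, hkc, hkp, ?_⟩
  filter_upwards [hf.eventually_mem hp, hdc.eventually_const_lt hd,
    hkc.eventually_ne (hkp.symm ▸ hA)] with q hq hdq hkq
  exact ⟨contDiffAt_largeRoot hf σ hq hdq, hkq, largeRoot_quadratic hσ hdq.le⟩

/-- Where `dλ ≠ 0`, regular points are dense. -/
theorem mem_closure_regularSet {f ν : ℝ × ℝ → E3} {S : Set (ℝ × ℝ)} (hf : IsNormalPair f ν S)
    {q : ℝ × ℝ} (hq : q ∈ S) (hl : fderiv ℝ (signedArea f ν) q ≠ 0) :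
    q ∈ closure (regularSet f) := by
  by_contra h
  apply hl
  have h1 : ∀ᶠ x in 𝓝 q, x ∉ regularSet f :=
    Filter.eventually_of_mem (isClosed_closure.isOpen_compl.mem_nhds h)
      fun x hx hx' => hx (subset_closure hx')
  -- Singular points are the zeros of λ; were all nearby points singular, dλ would vanish at q.
  have h2 : signedArea f ν =ᶠ[𝓝 q] fun _ => 0 := by
    filter_upwards [h1, hf.eventually_mem hq] with x hx hxS
    by_contra h0
    exact hx ((hf.signedArea_ne_zero_iff hxS).1 h0)
  rw [h2.fderiv_eq]; simp

/-- The principal curvatures exist near a nondegenerate singular point, one of them bounded. -/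
theorem exists_principalPair {f ν : ℝ × ℝ → E3} {S : Set (ℝ × ℝ)} (hf : IsNormalPair f ν S)
    {p : ℝ × ℝ} (hp : p ∈ S) (hl : signedArea f ν p = 0) (hA : mixedArea f ν p ≠ 0) :
    ∃ κ₁ κ₂ : ℝ × ℝ → ℝ, IsPrincipalPairAt f ν p κ₁ κ₂ := by
  obtain ⟨k, hkc, hkp, hk⟩ := exists_root hf hp hl hA
  -- By Vieta the roots are k and λB/k; divided by λ, the second is B/k, continuous at p.
  refine ⟨fun q => k q / signedArea f ν q, fun q => normalArea ν q / k q, ?_, ?_, ?_⟩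
  · filter_upwards [hk, hf.eventually_mem hp] with q ⟨_, hk0, hq⟩ hqS hreg
    have hl0 := (hf.signedArea_ne_zero_iff hqS).2 hreg
    rw [hf.meanCurv_eq hqS]
    field_simp
    linarith
  · filter_upwards [hk, hf.eventually_mem hp] with q ⟨_, hk0, hq⟩ hqS hreg
    rw [hf.gaussCurv_eq hqS]
    field_simp
  · have hc : ContinuousAt (fun q => |normalArea ν q / k q|) p :=
      ((contDiffAt_normalArea (hf.contDiffAt_normal hp)).continuousAt.div hkc (hkp ▸ hA)).abs
    exact ⟨|normalArea ν p / k p| + 1,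
      (hc.eventually_lt_const (lt_add_one _)).mono fun q hq _ => hq.le⟩

/-- `λ κ₁` is the nonvanishing root of the quadratic equation if `κ₂` is bounded. -/
theorem IsPrincipalPairAt.eventually_eq {f ν : ℝ × ℝ → E3} {S : Set (ℝ × ℝ)}
    (hf : IsNormalPair f ν S) {p : ℝ × ℝ} (hp : p ∈ S) (hl : signedArea f ν p = 0)
    {κ₁ κ₂ k : ℝ × ℝ → ℝ} (hκ : IsPrincipalPairAt f ν p κ₁ κ₂) (hkc : ContinuousAt k p)
    (hk0 : k p ≠ 0)
    (hk : ∀ᶠ q in 𝓝 p,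
      k q ^ 2 - mixedArea f ν q * k q + signedArea f ν q * normalArea ν q = 0) :
    ∀ᶠ q in 𝓝 p, q ∈ regularSet f → signedArea f ν q * κ₁ q = k q := by
  obtain ⟨M, hM⟩ := hκ.bounded
  have hlc := (contDiffAt_signedArea (hf.contDiffAt hp) (hf.contDiffAt_normal hp)).continuousAt
  -- At p one has λ = 0 ≠ k, so a κ₂ bounded by M cannot satisfy λκ₂ = k nearby.
  have hsmall : ∀ᶠ q in 𝓝 p, |signedArea f ν q| * M < |k q| := by
    have hc : ContinuousAt (fun q => |k q| - |signedArea f ν q| * M) p :=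
      hkc.abs.sub (hlc.abs.mul continuousAt_const)
    have h0 : 0 < |k p| - |signedArea f ν p| * M := by
      rw [hl, abs_zero, zero_mul, sub_zero]; exact abs_pos.2 hk0
    exact (hc.eventually_const_lt h0).mono fun q hq => sub_pos.1 hq
  filter_upwards [hk, hM, hsmall, hκ.add_eq, hκ.mul_eq, hf.eventually_mem hp] with
    q hq hMq hsq hadd hmul hqS hreg
  have hl0 := (hf.signedArea_ne_zero_iff hqS).2 hreg
  have ha := hadd hreg
  have hm := hmul hreg
  rw [hf.meanCurv_eq hqS] at ha
  rw [hf.gaussCurv_eq hqS] at hm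
  have ha' : signedArea f ν q * κ₁ q + signedArea f ν q * κ₂ q = mixedArea f ν q := by
    rw [← mul_add, ha]; field_simp
  have hm' : signedArea f ν q * κ₁ q * κ₂ q = normalArea ν q := by
    rw [mul_assoc, hm]; field_simp
  -- A and λB are the sum and product of λκ₁ and λκ₂, so the quadratic evaluated at k factors.
  have hfac : (signedArea f ν q * κ₁ q - k q) * (signedArea f ν q * κ₂ q - k q) = 0 := by
    rw [← ha', ← hm'] at hq
    linear_combination hq
  rcases mul_eq_zero.1 hfac with h | h
  · linarith
  · exfalso
    have h1 : |k q| = |signedArea f ν q| * |κ₂ q| := by rw [← sub_eq_zero.1 h, abs_mul]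
    have h2 := mul_le_mul_of_nonneg_left (hMq hreg) (abs_nonneg (signedArea f ν q))
    linarith

/-- The extension of `λ κ₁` agrees with the root of the quadratic equation. -/
theorem kappaHat_eq {f ν : ℝ × ℝ → E3} {S : Set (ℝ × ℝ)} (hf : IsNormalPair f ν S)
    {κ₁ k : ℝ × ℝ → ℝ} {q : ℝ × ℝ} (hq : q ∈ S) (hl : fderiv ℝ (signedArea f ν) q ≠ 0)
    (hk : ContinuousAt k q)
    (heq : ∀ᶠ x in 𝓝 q, x ∈ regularSet f → signedArea f ν x * κ₁ x = k x) :
    kappaHat f ν κ₁ q = k q := by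
  refine extendFrom_eq (mem_closure_regularSet hf hq hl) ?_
  refine (hk.tendsto.mono_left nhdsWithin_le_nhds).congr' ?_
  exact (eventually_nhdsWithin_iff.2 heq).mono fun x hx => hx.symm

end FocalSurface

/-! ### Assembly of the theorem. -/

open FocalSurface
theorem theorem3p6 (S : Set (ℝ × ℝ)) (hS : IsOpen S) (f ν : ℝ × ℝ → E3)
    (hf : IsFrontOn f ν S) (p : ℝ × ℝ) (hp : p ∈ S) (hcusp : IsCuspidalEdgeAt f p) :
    (∃ φ : OpenPartialHomeomorph (ℝ × ℝ) (ℝ × ℝ), IsAdaptedAt f S p φ) ∧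
    (∃ κ₁ κ₂ : ℝ × ℝ → ℝ, IsPrincipalPairAt f ν p κ₁ κ₂) ∧
    ∀ κ₁ κ₂ : ℝ × ℝ → ℝ, IsPrincipalPairAt f ν p κ₁ κ₂ →
      ∃ V : Set (ℝ × ℝ), IsOpen V ∧ p ∈ V ∧ V ⊆ S ∧
        ContDiffOn ℝ ∞ (kappaHat f ν κ₁) V ∧
        (∀ q ∈ V, kappaHat f ν κ₁ q ≠ 0) ∧
        (∀ q ∈ V, q ∈ regularSet f → kappaHat f ν κ₁ q = signedArea f ν q * κ₁ q) ∧
        ContDiffOn ℝ ∞ (focalHat f ν κ₁) V ∧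
        V ⊆ regularSet (focalHat f ν κ₁) ∧
        ∃ n : ℝ × ℝ → E3, IsUnitNormalOn (focalHat f ν κ₁) n V ∧
          ∀ φ : OpenPartialHomeomorph (ℝ × ℝ) (ℝ × ℝ), IsAdaptedAt f S p φ →
            ∀ u : ℝ, (u, 0) ∈ φ.source → φ (u, 0) ∈ V →
              gaussCurv (focalHat f ν κ₁) n (φ (u, 0)) =
                -(1 / 4) * (4 * cuspTorsion (f ∘ φ) u ^ 2 +
                  singularCurv (f ∘ φ) (ν ∘ φ) u * cuspidalCurv (f ∘ φ) u ^ 2) ∧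
              meanCurv (focalHat f ν κ₁) n (φ (u, 0)) =
                1 / 8 * (cuspidalCurv (f ∘ φ) u ^ 2 -
                  4 * singularCurv (f ∘ φ) (ν ∘ φ) u) ∧
              meanCurv (focalHat f ν κ₁) (-n) (φ (u, 0)) =
                -(1 / 8) * (cuspidalCurv (f ∘ φ) u ^ 2 -
                  4 * singularCurv (f ∘ φ) (ν ∘ φ) u) := by
  have hP : IsNormalPair f ν S := ⟨hS, hf.smooth, hf.normal⟩
  obtain ⟨φ₀, hφ₀, hdl, hA⟩ := nondegenerate_of_isCuspidalEdgeAt hS hf hp hcusp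
  have hl : signedArea f ν p = 0 := by
    have := hφ₀.signedArea_eq_zero hP (u := 0)
      ⟨hφ₀.zero_mem, hφ₀.target_subset (φ₀.map_source hφ₀.zero_mem)⟩
    rwa [hφ₀.map_zero] at this
  refine ⟨⟨φ₀, hφ₀⟩, exists_principalPair hP hp hl hA, fun κ₁ κ₂ hκ => ?_⟩
  obtain ⟨k, hkc, hkp, hk⟩ := exists_root hP hp hl hA
  have hdlc : ContinuousAt (fderiv ℝ (signedArea f ν)) p :=
    ((contDiffAt_signedArea (hP.contDiffAt hp) (hP.contDiffAt_normal hp)).fderiv_right (m := ∞)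
      (by simp)).continuousAt
  obtain ⟨V₀, hV₀, hV₀o, hpV₀⟩ := eventually_nhds_iff.1 ((hP.eventually_mem hp).and
    (hk.and ((hdlc.eventually_ne hdl).and (hκ.eventually_eq hP hp hl hkc (hkp ▸ hA)
      (hk.mono fun q hq => hq.2.2)))))
  have hhat : ∀ q ∈ V₀, kappaHat f ν κ₁ q = k q := fun q hq =>
    kappaHat_eq hP (hV₀ q hq).1 (hV₀ q hq).2.2.1 (hV₀ q hq).2.1.1.continuousAt
      (Filter.eventually_of_mem (hV₀o.mem_nhds hq) fun x hx => (hV₀ x hx).2.2.2)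
  have shat : ContDiffOn ℝ ∞ (kappaHat f ν κ₁) V₀ :=
    ContDiffOn.congr (fun q hq => (hV₀ q hq).2.1.1.contDiffWithinAt) hhat
  have hat0 : ∀ q ∈ V₀, kappaHat f ν κ₁ q ≠ 0 := fun q hq => by
    rw [hhat q hq]; exact (hV₀ q hq).2.1.2.1
  have hroot : ∀ q ∈ V₀, kappaHat f ν κ₁ q ^ 2 - mixedArea f ν q * kappaHat f ν κ₁ q +
      signedArea f ν q * normalArea ν q = 0 := fun q hq => by
    rw [hhat q hq]; exact (hV₀ q hq).2.1.2.2
  have hV₀S : V₀ ⊆ S := fun q hq => (hV₀ q hq).1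
  have sfocal : ContDiffOn ℝ ∞ (focalHat f ν κ₁) V₀ :=
    (hf.smooth.mono hV₀S).add ((ContDiffOn.div (fun q hq => (contDiffAt_signedArea
      (hP.contDiffAt (hV₀S hq)) (hP.contDiffAt_normal (hV₀S hq))).contDiffWithinAt) shat
      hat0).smul (hf.normal.smooth.mono hV₀S))
  -- Restriction to a smaller open set is the coordinate change `id`.
  have hres : ∀ {V : Set (ℝ × ℝ)}, IsOpen V → V ⊆ V₀ → IsNormalPair f ν V := fun hV hVV =>
    (hP.comp (φ := id) hV contDiffOn_id fun x hx => hV₀S (hVV hx))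
  have sfp : ∀ q ∈ V₀, ContDiffAt ℝ ∞ (focalHat f ν κ₁) q := fun q hq =>
    sfocal.contDiffAt (hV₀o.mem_nhds hq)
  have hcrp : cross (du (focalHat f ν κ₁) p) (dv (focalHat f ν κ₁) p) ≠ 0 := by
    have h0 := hφ₀.map_zero
    have := hφ₀.cross_focal_ne_zero (u := 0) (hres hV₀o subset_rfl) shat hat0 hroot
      ⟨hφ₀.zero_mem, by rw [Set.mem_preimage, h0]; exact hpV₀⟩ (by rw [h0]; exact hdl)
      (C := focalHat f ν κ₁) (by rw [h0]; exact (sfp p hpV₀).differentiableAt_top)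
      fun q => rfl
    rwa [h0] at this
  have hcrc : ContinuousAt
      (fun q => cross (du (focalHat f ν κ₁) q) (dv (focalHat f ν κ₁) q)) p :=
    (ContDiffAt.cross (contDiffAt_du (sfp p hpV₀)) (contDiffAt_dv (sfp p hpV₀))).continuousAt
  -- Regularity of the focal surface is verified only at p and spreads to V by continuity.
  obtain ⟨V, hV, hVo, hpV⟩ :=
    eventually_nhds_iff.1 ((hV₀o.eventually_mem hpV₀).and (hcrc.eventually_ne hcrp))
  have hVV : V ⊆ V₀ := fun q hq => (hV q hq).1
  -- Orienting by the sign of κ̂ fixes n before any adapted chart is chosen.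
  obtain ⟨n, hn, hns⟩ := exists_oriented_normal hVo (sfocal.mono hVV) (fun q hq => (hV q hq).2)
    (shat.mono hVV) fun q hq => hat0 q (hVV hq)
  have hC : IsNormalPair (focalHat f ν κ₁) n V := ⟨hVo, sfocal.mono hVV, hn⟩
  refine ⟨V, hVo, hpV, hVV.trans hV₀S, shat.mono hVV, fun q hq => hat0 q (hVV hq), ?_,
    sfocal.mono hVV, ?_, n, hn, ?_⟩
  · intro q hq hreg
    rw [hhat q (hVV hq)]
    exact ((hV₀ q (hVV hq)).2.2.2 hreg).symm
  · intro q hq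
    exact (hC.signedArea_ne_zero_iff hq).1 (right_ne_zero_of_mul (hns q hq).ne')
  · intro φ hφ u hu huV
    have key := hφ.focal_curvatures (hres hVo hVV) (shat.mono hVV) (fun q hq => hat0 q (hVV hq))
      (fun q hq => hroot q (hVV hq)) ⟨hu, huV⟩ (hV₀ _ (hVV huV)).2.2.1 hC (fun q => rfl)
      (hns _ huV)
    refine ⟨key.1, key.2, ?_⟩
    rw [meanCurv_neg, key.2]
    ring
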